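/- A Frölicher space is a set $X$ with a set $\mathcal C_X$ of curves $\mathbb R\to X$ and a set $\mathcal F_X$ of functions $X\to\mathbb R$ such that $\mathcal F_X=\{f : f\circ c\in C^\infty(\mathbb R)\ \forall c\in\mathcal C_X\}$ and $\mathcal C_X=\{c : f\circ c\in C^\infty(\mathbb R)\ \forall f\in\mathcal F_X\}$; the structure generated by a set $F_0$ of functions has as curves all $c$ with $f\circ c\in C^\infty(\mathbb R)$ for all $f\in F_0$. A map $\varphi:X\to Y$ is smooth if $f\circ\varphi\in\mathcal F_X$ for all $f\in\mathcal F_Y$. Subspaces and products carry the initial structure, coproducts and quotients the final structure. Let $I=[0,1]$ be the unit interval as a subspace of $\mathbb R$, and let $\mathbf I$ be the flattened unit interval: the set $[0,1]$ with the structure generated by those $f\in\mathcal F_I$ for which there is $0<\epsilon<\frac14$ with $f=f(0)$ on $[0,\epsilon)$ and $f=f(1)$ on $(1-\epsilon,1]$. Work in the category of pointed Frölicher spaces and basepoint preserving smooth maps. A homotopy between pointed maps $X\to Y$ is a smooth map $H:I\times X\to Y$ with $H(t,x_0)=y_0$ for all $t$; $[X,W]$ is the set of homotopy classes of pointed maps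 $X\to W$, pointed by the class of the constant map. The smash product $X\wedge Y$ is $X\times Y$ with $(\{x_0\}\times Y)\cup(X\times\{y_0\})$ identified to a point, the basepoint. The reduced flattened suspension is $\Sigma X=(\mathbf I/\{0,1\})\wedge X$. For a pointed map $i:A\to X$ with basepoint $a_0$ of $A$, the flattened mapping cone $\mathbf T_i$ is the quotient of $(\mathbf I\times A)\sqcup X$ in which $(1,a)$ is identified with $i(a)$ for each $a\in A$, and $(\{0\}\times A)\cup(\mathbf I\times\{a_0\})$ is identified to a point, the basepoint. Let $j:X\to\mathbf T_i$, $x\mapsto[x]$, be the inclusion and $k:\mathbf T_i\to\Sigma A$, $[t,a]\mapsto t\wedge a$, $[x]\mapsto *$, the quotient map. For $0<\epsilon<\frac12$ a braking function $\alpha_\epsilon:\mathbb R\to\mathbb R$ is a smooth function that is $0$ on $(-\infty,\epsilon]$, strictly increasing with values in $(0,1)$ on $(\epsilon,1-\epsilon)$, and $1$ on $[1-\epsilon,\infty)$. An injective pointed smooth map $i:A\to X$ is a cofibration if for every pointed $Z$, every pointed smooth map $f:X\to Z$ and every pointed homotopy $G:I\times A\to Z$ with $G(0,a)=f(i(a))$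 for all $a\in A$, there are a braking function $\alpha_\epsilon$ for some $0<\epsilon<\frac12$ and a pointed homotopy $F:I\times X\to Z$ with $F(0,x)=f(x)$ for all $x\in X$ and $F(t,i(a))=G(\alpha_\epsilon(t),a)$ for all $t\in I$, $a\in A$. **Theorem.** Let $i:A\to X$ be a cofibration of pointed Frölicher spaces and let $W$ be a pointed Frölicher space. Then the sequence of pointed sets $$\cdots\to[\Sigma^{n+1}A,W]\xrightarrow{(\Sigma^nk)^*}[\Sigma^n\mathbf T_i,W]\xrightarrow{(\Sigma^nj)^*}[\Sigma^nX,W]\xrightarrow{(\Sigma^ni)^*}[\Sigma^nA,W]\to\cdots\to[\Sigma A,W]\xrightarrow{k^*}[\mathbf T_i,W]\xrightarrow{j^*}[X,W]\xrightarrow{i^*}[A,W]$$ is exact: at each of its terms other than the last term $[A,W]$, the image of the incoming map is the preimage of the basepoint under the outgoing map. That is, for every $n\ge 0$ it is exact at $[\Sigma^nX,W]$, at $[\Sigma^n\mathbf T_i,W]$ and at $[\Sigma^{n+1}A,W]$. -/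

import Mathlib

open scoped ContDiff

universe u v w

/-- A Frölicher structure on `X`: a set of curves and a set of functions that determine each
other through smoothness of the composites `ℝ → X → ℝ`. -/
class FrolicherSpace (X : Type u) where
  curves : Set (ℝ → X)
  functions : Set (X → ℝ)
  mem_functions_iff : ∀ f : X → ℝ, f ∈ functions ↔ ∀ c ∈ curves, ContDiff ℝ ∞ (f ∘ c)
  mem_curves_iff : ∀ c : ℝ → X, c ∈ curves ↔ ∀ f ∈ functions, ContDiff ℝ ∞ (f ∘ c)

namespace FrolicherSpace

/-- The structure generated by a set `F₀` of functions: curves `Γ F₀`, functions `Φ Γ F₀`. -/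
@[reducible]
def ofFunctions {X : Type u} (F₀ : Set (X → ℝ)) : FrolicherSpace X where
  curves := {c | ∀ f ∈ F₀, ContDiff ℝ ∞ (f ∘ c)}
  functions := {f | ∀ c : ℝ → X, (∀ g ∈ F₀, ContDiff ℝ ∞ (g ∘ c)) → ContDiff ℝ ∞ (f ∘ c)}
  mem_functions_iff _ := Iff.rfl
  mem_curves_iff c := ⟨fun hc _ hf => hf c hc, fun h g hg => h g fun _ hc => hc g hg⟩

/-- The structure generated by a set `C₀` of curves: functions `Φ C₀`, curves `Γ Φ C₀`. -/
@[reducible]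
def ofCurves {X : Type u} (C₀ : Set (ℝ → X)) : FrolicherSpace X where
  functions := {f | ∀ c ∈ C₀, ContDiff ℝ ∞ (f ∘ c)}
  curves := {c | ∀ f : X → ℝ, (∀ d ∈ C₀, ContDiff ℝ ∞ (f ∘ d)) → ContDiff ℝ ∞ (f ∘ c)}
  mem_functions_iff f := ⟨fun hf _ hc => hc f hf, fun h c hc => h c fun _ hf => hf c hc⟩
  mem_curves_iff _ := Iff.rfl

/-- The initial structure along one map. -/
@[reducible]
def induced {X : Type u} {Y : Type v} [FrolicherSpace Y] (φ : X → Y) : FrolicherSpace X :=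
  ofFunctions {f | ∃ g ∈ functions (X := Y), f = g ∘ φ}

/-- The final structure along one map. -/
@[reducible]
def coinduced {X : Type u} {Y : Type v} [FrolicherSpace X] (φ : X → Y) : FrolicherSpace Y :=
  ofCurves {d | ∃ c ∈ curves (X := X), d = φ ∘ c}

/-- The standard structure of the real line. -/
instance instReal : FrolicherSpace ℝ where
  curves := {c | ContDiff ℝ ∞ c}
  functions := {f | ContDiff ℝ ∞ f}
  mem_functions_iff _ := ⟨fun hf _ hc => ContDiff.comp hf hc, fun h => h id (contDiff_id (𝕜 := ℝ) (E := ℝ) (n := ∞))⟩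
  mem_curves_iff _ := ⟨fun hc _ hf => ContDiff.comp hf hc, fun h => h id (contDiff_id (𝕜 := ℝ) (E := ℝ) (n := ∞))⟩

/-- The usual unit interval, as a subspace of the real line. -/
instance instUnitInterval : FrolicherSpace unitInterval := induced (Subtype.val : unitInterval → ℝ)

/-- The product structure. -/
instance instProd {X : Type u} {Y : Type v} [FrolicherSpace X] [FrolicherSpace Y] :
    FrolicherSpace (X × Y) :=
  ofFunctions ({f | ∃ g ∈ functions (X := X), f = g ∘ Prod.fst} ∪
    {f | ∃ g ∈ functions (X := Y), f = g ∘ Prod.snd})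

/-- The coproduct structure. -/
instance instSum {X : Type u} {Y : Type v} [FrolicherSpace X] [FrolicherSpace Y] :
    FrolicherSpace (X ⊕ Y) :=
  ofCurves ({d | ∃ c ∈ curves (X := X), d = Sum.inl ∘ c} ∪
    {d | ∃ c ∈ curves (X := Y), d = Sum.inr ∘ c})

/-- A quotient carries the final structure along the quotient map. -/
instance instQuot {X : Type u} [FrolicherSpace X] (r : X → X → Prop) : FrolicherSpace (Quot r) :=
  coinduced (Quot.mk r)

end FrolicherSpace

open FrolicherSpace

/-- Smooth maps of Frölicher spaces. -/
def FrlSmooth {X : Type u} {Y : Type v} [FrolicherSpace X] [FrolicherSpace Y] (φ : X → Y) : Prop :=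
  ∀ f ∈ functions (X := Y), f ∘ φ ∈ functions (X := X)

namespace FrlSmooth

variable {X : Type u} {Y : Type v} {Z : Type w}
variable [FrolicherSpace X] [FrolicherSpace Y] [FrolicherSpace Z]

theorem iff_curves {φ : X → Y} :
    FrlSmooth φ ↔ ∀ c ∈ curves (X := X), φ ∘ c ∈ curves (X := Y) := by
  constructor
  · intro h c hc
    rw [mem_curves_iff]
    intro f hf
    exact (mem_functions_iff _).1 (h f hf) c hc
  · intro h f hf
    rw [mem_functions_iff]
    intro c hc
    exact (mem_functions_iff f).1 hf _ (h c hc)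

theorem id : FrlSmooth (fun x : X => x) := fun _ hf => hf

theorem comp {ψ : Y → Z} {φ : X → Y} (hψ : FrlSmooth ψ) (hφ : FrlSmooth φ) :
    FrlSmooth (fun x => ψ (φ x)) := fun f hf => hφ _ (hψ f hf)

theorem const (y : Y) : FrlSmooth (fun _ : X => y) := by
  intro f _
  rw [mem_functions_iff]
  intro c _
  exact contDiff_const

theorem mem_curves_prod {c : ℝ → X × Y} :
    c ∈ curves (X := X × Y) ↔
      (fun s => (c s).1) ∈ curves (X := X) ∧ (fun s => (c s).2) ∈ curves (X := Y) := by
  constructor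
  · intro h
    exact ⟨(mem_curves_iff _).2 fun f hf => h _ (Or.inl ⟨f, hf, rfl⟩),
      (mem_curves_iff _).2 fun f hf => h _ (Or.inr ⟨f, hf, rfl⟩)⟩
  · rintro ⟨h₁, h₂⟩ f (⟨g, hg, rfl⟩ | ⟨g, hg, rfl⟩)
    · exact (mem_curves_iff _).1 h₁ g hg
    · exact (mem_curves_iff _).1 h₂ g hg

theorem fst : FrlSmooth (fun p : X × Y => p.1) :=
  iff_curves.2 fun _ hc => (mem_curves_prod.1 hc).1

theorem snd : FrlSmooth (fun p : X × Y => p.2) :=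
  iff_curves.2 fun _ hc => (mem_curves_prod.1 hc).2

theorem prodMk {φ : Z → X} {ψ : Z → Y} (hφ : FrlSmooth φ) (hψ : FrlSmooth ψ) :
    FrlSmooth (fun z => (φ z, ψ z)) :=
  iff_curves.2 fun c hc => mem_curves_prod.2 ⟨iff_curves.1 hφ c hc, iff_curves.1 hψ c hc⟩

theorem inl : FrlSmooth (Sum.inl : X → X ⊕ Y) := fun _ hf =>
  (mem_functions_iff _).2 fun c hc => hf _ (Or.inl ⟨c, hc, rfl⟩)

theorem inr : FrlSmooth (Sum.inr : Y → X ⊕ Y) := fun _ hf =>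
  (mem_functions_iff _).2 fun c hc => hf _ (Or.inr ⟨c, hc, rfl⟩)

theorem sumElim {φ : X → Z} {ψ : Y → Z} (hφ : FrlSmooth φ) (hψ : FrlSmooth ψ) :
    FrlSmooth (Sum.elim φ ψ) := by
  rintro f hf d (⟨c, hc, rfl⟩ | ⟨c, hc, rfl⟩)
  · exact (mem_functions_iff _).1 (hφ f hf) c hc
  · exact (mem_functions_iff _).1 (hψ f hf) c hc

theorem quotMk (r : X → X → Prop) : FrlSmooth (Quot.mk r) := fun _ hf =>
  (mem_functions_iff _).2 fun c hc => hf _ ⟨c, hc, rfl⟩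

theorem quotLift {r : X → X → Prop} {φ : X → Y} (hφ : FrlSmooth φ)
    (h : ∀ a b, r a b → φ a = φ b) : FrlSmooth (Quot.lift φ h) := by
  rintro f hf d ⟨c, hc, rfl⟩
  exact (mem_functions_iff _).1 (hφ f hf) c hc

theorem mem_curves_unitInterval {c : ℝ → unitInterval} :
    c ∈ curves (X := unitInterval) ↔ ContDiff ℝ ∞ (fun s => (c s : ℝ)) := by
  constructor
  · intro h
    exact h Subtype.val ⟨_root_.id, contDiff_id (𝕜 := ℝ) (E := ℝ) (n := ∞), rfl⟩
  · rintro h f ⟨g, hg, rfl⟩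
    exact ContDiff.comp (g := g) hg h

/-- A smooth real function with values in `[0, 1]` is smooth on the unit interval. -/
theorem unitInterval_of_contDiff {φ : ℝ → ℝ} (hφ : ContDiff ℝ ∞ φ) (h : ∀ t, φ t ∈ unitInterval) :
    FrlSmooth (fun t : unitInterval => (⟨φ t, h t⟩ : unitInterval)) := by
  rw [iff_curves]
  intro c hc
  rw [mem_curves_unitInterval] at hc ⊢
  exact hφ.comp hc

theorem symm : FrlSmooth unitInterval.symm := by
  rw [iff_curves]
  intro c hc
  rw [mem_curves_unitInterval] at hc ⊢
  simpa using contDiff_const.sub hc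

end FrlSmooth

/-- The underlying set of the flattened unit interval. -/
def FlatInterval : Type := unitInterval

/-- The flattened structure on `[0, 1]`: it is generated by the smooth functions on the usual unit
interval that are constant near `0` and constant near `1`. -/
instance FlatInterval.instFrolicherSpace : FrolicherSpace FlatInterval :=
  ofFunctions (X := unitInterval) {f | f ∈ functions (X := unitInterval) ∧
    ∃ ε : ℝ, 0 < ε ∧ ε < 1 / 4 ∧
      (∀ t : unitInterval, (t : ℝ) < ε → f t = f 0) ∧
      (∀ t : unitInterval, 1 - ε < (t : ℝ) → f t = f 1)}

/-- The left endpoint of the flattened unit interval. -/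
def FlatInterval.zero : FlatInterval := (0 : unitInterval)

/-- The right endpoint of the flattened unit interval. -/
def FlatInterval.one : FlatInterval := (1 : unitInterval)

/-- The space `X / S` obtained by identifying the points of `S`, with the final structure. -/
abbrev Collapse {X : Type u} (S : Set X) : Type u :=
  Quot fun x y : X => x ∈ S ∧ y ∈ S

/-- A pointed Frölicher space. -/
structure PointedFrl : Type (u + 1) where
  carrier : Type u
  [str : FrolicherSpace carrier]
  pt : carrier

namespace PointedFrl

instance : CoeSort PointedFrl.{u} (Type u) := ⟨carrier⟩

instance (X : PointedFrl.{u}) : FrolicherSpace X := X.str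

/-- Smooth maps that preserve the basepoint. -/
@[ext]
structure Hom (X : PointedFrl.{u}) (Y : PointedFrl.{v}) where
  toFun : X → Y
  smooth : FrlSmooth toFun
  map_pt : toFun X.pt = Y.pt

instance (X : PointedFrl.{u}) (Y : PointedFrl.{v}) : CoeFun (Hom X Y) fun _ => X → Y := ⟨Hom.toFun⟩

/-- Composition, `g` after `f`. -/
def Hom.comp {X : PointedFrl.{u}} {Y : PointedFrl.{v}} {Z : PointedFrl.{w}}
    (g : Hom Y Z) (f : Hom X Y) : Hom X Z :=
  ⟨fun x => g (f x), g.smooth.comp f.smooth, by rw [f.map_pt, g.map_pt]⟩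

/-- The constant map at the basepoint. -/
def Hom.trivial (X : PointedFrl.{u}) (Y : PointedFrl.{v}) : Hom X Y :=
  ⟨fun _ => Y.pt, FrlSmooth.const _, rfl⟩

/-- Two pointed maps are homotopic if they are joined by a smooth basepoint preserving homotopy
parametrized by the usual unit interval. -/
def Homotopic {X : PointedFrl.{u}} {Y : PointedFrl.{v}} (f g : Hom X Y) : Prop :=
  ∃ H : unitInterval × X → Y, FrlSmooth H ∧ (∀ t, H (t, X.pt) = Y.pt) ∧
    (∀ x, H (0, x) = f x) ∧ (∀ x, H (1, x) = g x)

theorem Homotopic.refl {X : PointedFrl.{u}} {Y : PointedFrl.{v}} (f : Hom X Y) : Homotopic f f :=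
  ⟨fun p => f p.2, f.smooth.comp FrlSmooth.snd, fun _ => f.map_pt, fun _ => rfl, fun _ => rfl⟩

theorem Homotopic.symm {X : PointedFrl.{u}} {Y : PointedFrl.{v}} {f g : Hom X Y}
    (h : Homotopic f g) : Homotopic g f := by
  obtain ⟨H, hH, hp, h0, h1⟩ := h
  refine ⟨fun p => H (unitInterval.symm p.1, p.2), ?_, fun t => hp _, ?_, ?_⟩
  · exact hH.comp ((FrlSmooth.symm.comp FrlSmooth.fst).prodMk FrlSmooth.snd)
  · intro x; simpa using h1 x
  · intro x; simpa using h0 x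

theorem Homotopic.trans {X : PointedFrl.{u}} {Y : PointedFrl.{v}} {f g k : Hom X Y}
    (h : Homotopic f g) (h' : Homotopic g k) : Homotopic f k := by
  obtain ⟨H, hH, hp, h0, h1⟩ := h
  obtain ⟨H', hH', hp', h0', h1'⟩ := h'
  have mem : ∀ t, Real.smoothTransition t ∈ unitInterval := fun t =>
    ⟨Real.smoothTransition.nonneg t, Real.smoothTransition.le_one t⟩
  let σ : unitInterval → unitInterval := fun t => ⟨Real.smoothTransition (2 * t), mem _⟩
  let τ : unitInterval → unitInterval := fun t =>
    ⟨Real.smoothTransition (5 / 2 * t - 3 / 2), mem _⟩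
  have hσ : FrlSmooth σ := FrlSmooth.unitInterval_of_contDiff
    (φ := fun t => Real.smoothTransition (2 * t))
    (Real.smoothTransition.contDiff.comp (by fun_prop)) fun _ => mem _
  have hτ : FrlSmooth τ := FrlSmooth.unitInterval_of_contDiff
    (φ := fun t => Real.smoothTransition (5 / 2 * t - 3 / 2))
    (Real.smoothTransition.contDiff.comp (by fun_prop)) fun _ => mem _
  have σ1 : ∀ t : unitInterval, 1 / 2 ≤ (t : ℝ) → σ t = 1 := fun t ht =>
    Subtype.ext (Real.smoothTransition.one_of_one_le (by linarith))
  have τ0 : ∀ t : unitInterval, (t : ℝ) ≤ 3 / 5 → τ t = 0 := fun t ht =>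
    Subtype.ext (Real.smoothTransition.zero_of_nonpos (by linarith))
  have σ0 : σ 0 = 0 := Subtype.ext (Real.smoothTransition.zero_of_nonpos (by simp))
  have τ1 : τ 1 = 1 := Subtype.ext (Real.smoothTransition.one_of_one_le (by norm_num))
  have hHσ : FrlSmooth fun p : unitInterval × X => H (σ p.1, p.2) :=
    hH.comp ((hσ.comp FrlSmooth.fst).prodMk FrlSmooth.snd)
  have hHτ : FrlSmooth fun p : unitInterval × X => H' (τ p.1, p.2) :=
    hH'.comp ((hτ.comp FrlSmooth.fst).prodMk FrlSmooth.snd)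
  let K : unitInterval × X → Y := fun p =>
    if (p.1 : ℝ) ≤ 1 / 2 then H (σ p.1, p.2) else H' (τ p.1, p.2)
  have Kσ : ∀ p : unitInterval × X, (p.1 : ℝ) < 3 / 5 → K p = H (σ p.1, p.2) := by
    intro p hlt
    by_cases hle : (p.1 : ℝ) ≤ 1 / 2
    · simp only [K, if_pos hle]
    · simp only [K, if_neg hle]
      rw [τ0 _ hlt.le, σ1 _ (not_le.1 hle).le, h0', h1]
  have Kτ : ∀ p : unitInterval × X, 1 / 2 < (p.1 : ℝ) → K p = H' (τ p.1, p.2) := by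
    intro p hlt
    simp only [K, if_neg (not_le.2 hlt)]
  refine ⟨K, ?_, ?_, ?_, ?_⟩
  · intro e he
    rw [mem_functions_iff]
    intro c hc
    have ht : ContDiff ℝ ∞ fun s => ((c s).1 : ℝ) :=
      FrlSmooth.mem_curves_unitInterval.1 (FrlSmooth.mem_curves_prod.1 hc).1
    have c1 := (mem_functions_iff _).1 (hHσ e he) c hc
    have c2 := (mem_functions_iff _).1 (hHτ e he) c hc
    rw [contDiff_iff_contDiffAt]
    intro s
    by_cases hs : ((c s).1 : ℝ) < 3 / 5
    · refine c1.contDiffAt.congr_of_eventuallyEq ?_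
      filter_upwards [ht.continuous.continuousAt.eventually_lt continuousAt_const hs] with r hr
      simp only [Function.comp_apply]
      rw [Kσ _ hr]
    · refine c2.contDiffAt.congr_of_eventuallyEq ?_
      have hs' : 1 / 2 < ((c s).1 : ℝ) := by linarith [not_lt.1 hs]
      filter_upwards [continuousAt_const.eventually_lt ht.continuous.continuousAt hs'] with r hr
      simp only [Function.comp_apply]
      rw [Kτ _ hr]
  · intro t
    by_cases hle : (t : ℝ) ≤ 1 / 2
    · simp only [K, if_pos hle, hp]
    · simp only [K, if_neg hle, hp']
  · intro x
    rw [Kσ _ (by norm_num), σ0, h0]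
  · intro x
    rw [Kτ _ (by norm_num), τ1, h1']

/-- Pointed smooth homotopy as an equivalence relation. -/
def homotopySetoid (X : PointedFrl.{u}) (Y : PointedFrl.{v}) : Setoid (Hom X Y) where
  r := Homotopic
  iseqv := ⟨Homotopic.refl, Homotopic.symm, Homotopic.trans⟩

/-- The pointed set `[X, W]` of homotopy classes of pointed smooth maps; its basepoint is the class
of the constant map. -/
def HomotopyClasses (X : PointedFrl.{u}) (W : PointedFrl.{v}) : Pointed.{max u v} where
  X := Quotient (homotopySetoid X W)
  point := Quotient.mk (homotopySetoid X W) (Hom.trivial X W)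

/-- The map `f^* : [Y, W] → [X, W]`, `[g] ↦ [g ∘ f]`. -/
def Hom.pullback {X Y : PointedFrl.{u}} (f : Hom X Y) (W : PointedFrl.{v}) :
    Pointed.Hom (HomotopyClasses Y W) (HomotopyClasses X W) where
  toFun := Quotient.map (fun g : Hom Y W => g.comp f) (by
    rintro g g' ⟨H, hH, hp, h0, h1⟩
    refine ⟨fun p => H (p.1, f p.2), ?_, ?_, fun x => h0 _, fun x => h1 _⟩
    · exact hH.comp (FrlSmooth.fst.prodMk (f.smooth.comp FrlSmooth.snd))
    · intro t
      change H (t, f X.pt) = _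
      rw [f.map_pt, hp])
  map_point := rfl

/-- The smash product (reduced join) `X ∧ Y`. -/
def smash (X : PointedFrl.{u}) (Y : PointedFrl.{v}) : PointedFrl.{max u v} where
  carrier := Collapse {p : X × Y | p.1 = X.pt ∨ p.2 = Y.pt}
  pt := Quot.mk _ (X.pt, Y.pt)

/-- The space `𝐈 / {0, 1}`, pointed by the class of the endpoints. -/
def flatCircle : PointedFrl.{0} where
  carrier := Collapse {t : FlatInterval | t = FlatInterval.zero ∨ t = FlatInterval.one}
  pt := Quot.mk _ FlatInterval.zero

/-- The reduced flattened suspension. -/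
def susp (X : PointedFrl.{u}) : PointedFrl.{u} := smash flatCircle X

/-- The point `t ∧ x` of the suspension. -/
def suspMk {X : PointedFrl.{u}} (t : FlatInterval) (x : X) : susp X :=
  Quot.mk _ ((Quot.mk _ t : flatCircle), x)

theorem suspMk_eq_pt {X : PointedFrl.{u}} {t : FlatInterval} {x : X}
    (h : t = FlatInterval.zero ∨ t = FlatInterval.one ∨ x = X.pt) :
    suspMk t x = (susp X).pt := by
  refine Quot.sound ⟨?_, Or.inl rfl⟩
  rcases h with rfl | rfl | rfl
  · exact Or.inl rfl
  · exact Or.inl (Quot.sound ⟨Or.inr rfl, Or.inl rfl⟩)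
  · exact Or.inr rfl

theorem suspMk_smooth {X : PointedFrl.{u}} :
    FrlSmooth fun p : FlatInterval × X => suspMk p.1 p.2 :=
  (FrlSmooth.quotMk _).comp (((FrlSmooth.quotMk _).comp FrlSmooth.fst).prodMk FrlSmooth.snd)

/-- The suspension of a pointed map, `[s, x] ↦ [s, f x]`. -/
def Hom.susp {X Y : PointedFrl.{u}} (f : Hom X Y) :
    Hom (PointedFrl.susp X) (PointedFrl.susp Y) where
  toFun := Quot.lift
    (fun p : flatCircle × X => (Quot.mk _ (p.1, f p.2) : PointedFrl.susp Y)) (by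
      rintro a b ⟨ha, hb⟩
      refine Quot.sound ⟨ha.imp id fun h => ?_, hb.imp id fun h => ?_⟩
      · simp only [h, f.map_pt]
      · simp only [h, f.map_pt])
  smooth := FrlSmooth.quotLift
    ((FrlSmooth.quotMk _).comp (FrlSmooth.fst.prodMk (f.smooth.comp FrlSmooth.snd))) _
  map_pt := congrArg (fun y => (Quot.mk _ (flatCircle.pt, y) : PointedFrl.susp Y)) f.map_pt

/-- The iterated suspension, with `Σⁿ⁺¹ X = Σⁿ (Σ X)`. -/
def iterSusp : ℕ → PointedFrl.{u} → PointedFrl.{u}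
  | 0, X => X
  | n + 1, X => iterSusp n (susp X)

/-- The iterated suspension of a pointed map. -/
def Hom.iterSusp : ∀ (n : ℕ) {X Y : PointedFrl.{u}}, Hom X Y →
    Hom (PointedFrl.iterSusp n X) (PointedFrl.iterSusp n Y)
  | 0, _, _, f => f
  | n + 1, _, _, f => Hom.iterSusp n f.susp

/-- The flattened mapping cylinder `𝐈_f`: the pushout of `f : A → X` along `a ↦ (1, a)`. -/
abbrev FlatCylinder {A X : PointedFrl.{u}} (f : Hom A X) : Type u :=
  Quot fun p q : (FlatInterval × A) ⊕ X =>
    ∃ a : A, p = Sum.inl (FlatInterval.one, a) ∧ q = Sum.inr (f a)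

/-- The subset `{0} × A ∪ 𝐈 × {a₀}` of the flattened mapping cylinder. -/
def flatConeBase {A X : PointedFrl.{u}} (f : Hom A X) : Set (FlatCylinder f) :=
  {z | ∃ (t : FlatInterval) (a : A), (t = FlatInterval.zero ∨ a = A.pt) ∧
    z = Quot.mk _ (Sum.inl (t, a))}

/-- The flattened mapping cone `𝐓_f` in the pointed category: in the flattened mapping cylinder
the bottom `{0} × A` and the interval `𝐈 × {a₀}` over the basepoint are identified to one point,
the basepoint, which is also the class of the basepoint of `X`. -/
def flatCone {A X : PointedFrl.{u}} (f : Hom A X) : PointedFrl.{u} where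
  carrier := Collapse (flatConeBase f)
  pt := Quot.mk _ (Quot.mk _ (Sum.inl (FlatInterval.zero, A.pt)))

/-- The inclusion `j : X → 𝐓_f`, `x ↦ [x]`. -/
def coneIncl {A X : PointedFrl.{u}} (f : Hom A X) : Hom X (flatCone f) where
  toFun x := Quot.mk _ (Quot.mk _ (Sum.inr x))
  smooth := (FrlSmooth.quotMk _).comp ((FrlSmooth.quotMk _).comp FrlSmooth.inr)
  map_pt := by
    refine Quot.sound ⟨⟨FlatInterval.one, A.pt, Or.inr rfl, ?_⟩,
      ⟨FlatInterval.zero, A.pt, Or.inr rfl, rfl⟩⟩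
    exact (Quot.sound ⟨A.pt, rfl, by rw [f.map_pt]⟩).symm

/-- The map `𝐈_f → Σ A`, `[t, a] ↦ t ∧ a`, `[x] ↦ *`. -/
def cylinderQuot {A X : PointedFrl.{u}} (f : Hom A X) : FlatCylinder f → susp A :=
  Quot.lift (Sum.elim (fun p : FlatInterval × A => suspMk p.1 p.2) fun _ => (susp A).pt) (by
    rintro _ _ ⟨a, rfl, rfl⟩
    exact suspMk_eq_pt (Or.inr (Or.inl rfl)))

theorem cylinderQuot_eq_pt {A X : PointedFrl.{u}} (f : Hom A X) {z : FlatCylinder f}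
    (hz : z ∈ flatConeBase f) : cylinderQuot f z = (susp A).pt := by
  obtain ⟨t, a, h, rfl⟩ := hz
  exact suspMk_eq_pt (h.imp id Or.inr)

/-- The quotient map `k : 𝐓_f → Σ A` that collapses `X` to the basepoint: `[t, a] ↦ t ∧ a` and
`[x] ↦ *`. -/
def coneQuot {A X : PointedFrl.{u}} (f : Hom A X) : Hom (flatCone f) (susp A) where
  toFun := Quot.lift (cylinderQuot f) fun _ _ h =>
    (cylinderQuot_eq_pt f h.1).trans (cylinderQuot_eq_pt f h.2).symm
  smooth := FrlSmooth.quotLift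
    (FrlSmooth.quotLift (FrlSmooth.sumElim suspMk_smooth (FrlSmooth.const _)) _) _
  map_pt := rfl

/-- A smooth braking function `α_ε`. -/
structure IsBraking (ε : ℝ) (α : ℝ → ℝ) : Prop where
  smooth : ContDiff ℝ ∞ α
  eq_zero : ∀ t ≤ ε, α t = 0
  mem_Ioo : ∀ t, ε < t → t < 1 - ε → 0 < α t ∧ α t < 1
  strictMono : StrictMonoOn α (Set.Ioo ε (1 - ε))
  eq_one : ∀ t, 1 - ε ≤ t → α t = 1

/-- A smooth cofibration in the pointed category: an injective pointed map `i : A → X` such that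
for every pointed map `f : X → Z` and pointed homotopy `G` starting at `f ∘ i`, the homotopy
`(t, a) ↦ G (α_ε t, a)`, for some braking function with `0 < ε < 1 / 2`, extends to a pointed
homotopy on `X` starting at `f`. The projection `Set.projIcc` does nothing but restrict the codomain
of the braking function to `[0, 1]`. -/
structure IsCofibration {A X : PointedFrl.{u}} (i : Hom A X) : Prop where
  injective : Function.Injective i
  extend : ∀ (Z : PointedFrl.{u}) (f : Hom X Z) (G : unitInterval × A → Z), FrlSmooth G →
    (∀ t, G (t, A.pt) = Z.pt) → (∀ a, G (0, a) = f (i a)) →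
    ∃ (ε : ℝ) (α : ℝ → ℝ), 0 < ε ∧ ε < 1 / 2 ∧ IsBraking ε α ∧
      ∃ F : unitInterval × X → Z, FrlSmooth F ∧ (∀ t, F (t, X.pt) = Z.pt) ∧
        (∀ x, F (0, x) = f x) ∧
        ∀ (t : unitInterval) (a : A), F (t, i a) = G (Set.projIcc 0 1 zero_le_one (α t), a)

end PointedFrl

/-- Exactness of `P → Q → R` at `Q`, for maps of pointed sets: the image of the first map is the
preimage of the basepoint under the second. -/
def Pointed.ExactAt {P Q R : Pointed.{u}} (f : Pointed.Hom P Q) (g : Pointed.Hom Q R) : Prop :=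
  Set.range f.toFun = g.toFun ⁻¹' {R.point}

-- The three lowest exactness statements come from explicit homotopies, and all the others follow by
-- adjunction. A null-homotopy of `h ∘ i` is the same as an extension of `h` over the cone
-- (`exactAt_base`). A null-homotopy on `X` of a map on the cone is absorbed into a collar of the
-- cone, after which the map factors through `Σ A` (`exactAt_cone`). A null-homotopy `N` of `h ∘ k`
-- is a map on the square of homotopy time and cone coordinate; `h` reads it along one edge, and
-- sliding that path to the opposite corner gives a path along which only points of `X` occur, hence
-- a map on `Σ X` (`exactAt_susp_base`). Braking reparametrizations make these formulas smooth on
-- the flattened interval.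
--
-- For the higher terms, maps `Σ Y → W` correspond to maps `Y → Ω W`, compatibly with homotopy. So a
-- pair of maps that is exact for all targets stays so after suspension (`exactAt_susp`), and no
-- iteration of mapping cones is needed.
--
-- The analytic burden is that homotopies on quotients and coproducts must be smooth once they are
-- smooth on the pieces, and that evaluation on mapping spaces is smooth. Both follow from
-- `FrlSmooth.of_generating`, which rests on `contDiff_diag`: smoothness of `(s, y) ↦ g s y` along
-- `ℝ × c` for all generating curves `c` gives smoothness of `t ↦ g t (d t)` for every curve `d` of
-- the generated structure. Such a `d` is known only through real functions on `Y`, so `g` is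
-- expanded in a Fourier series in `s`. Every combination of its coefficients with weights of
-- polynomial growth is a smooth function of `y`, by a Boman-type estimate for functions smooth
-- along plane curves, and therefore is smooth along `d`. Uniform boundedness turns smoothness of
-- all these scalar combinations into locally uniform rapid decay of the coefficients and their
-- derivatives along `d`, and the series can then be summed on the diagonal.

universe x

/-! ### Superpositions of bumps and the special curve lemma. -/

section Analysis

open Filter Topology Set

theorem iteratedDeriv_comp_affine {E : Type*} [NormedAddCommGroup E] [NormedSpace ℝ E]
    {f : ℝ → E} (hf : ContDiff ℝ ∞ f) (a v r : ℝ) (p : ℕ) :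
    iteratedDeriv p (fun u => f (a + v * (u - r))) =
      fun u => v ^ p • iteratedDeriv p f (a + v * (u - r)) := by
  induction p with
  | zero => simp
  | succ p ih =>
    rw [iteratedDeriv_succ, ih]
    ext u
    have h1 : HasDerivAt (iteratedDeriv p f) (iteratedDeriv (p + 1) f (a + v * (u - r)))
        (a + v * (u - r)) := by
      rw [iteratedDeriv_succ]
      exact ((hf.differentiable_iteratedDeriv p (by exact_mod_cast WithTop.coe_lt_top _))
        _).hasDerivAt
    have h2 : HasDerivAt (fun u => a + v * (u - r)) v u := by
      simpa using (((hasDerivAt_id u).sub_const r).const_mul v).const_add a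
    have h3 := ((h1.scomp u h2).const_smul (v ^ p)).deriv
    rw [smul_smul, ← pow_succ] at h3
    exact h3

/-- A superposition of rescaled copies of one compactly supported smooth function is smooth if
its coefficients decay geometrically and its scales grow polynomially. -/
theorem contDiff_tsum_rescaled {φ : ℝ → ℝ} (hφ : ContDiff ℝ ∞ φ) (hc : HasCompactSupport φ)
    (a r : ℕ → ℝ) (ha : ∀ n, |a n| ≤ (1 / 2) ^ n) :
    ContDiff ℝ ∞ fun u => ∑' n : ℕ, a n * φ (8 * ((n : ℝ) + 2) ^ 2 * (u - r n)) := by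
  have hbd : ∀ k : ℕ, ∃ C, ∀ x, ‖iteratedDeriv k φ x‖ ≤ C := by
    intro k
    obtain ⟨C, hC⟩ := (hc.iteratedFDeriv (𝕜 := ℝ) k).exists_bound_of_continuous
      (hφ.continuous_iteratedFDeriv (m := k) (by exact_mod_cast le_top))
    exact ⟨C, fun x => by rw [← norm_iteratedFDeriv_eq_norm_iteratedDeriv]; exact hC x⟩
  choose C hC using hbd
  have h0 : ∀ n : ℕ, (fun u => φ (8 * ((n : ℝ) + 2) ^ 2 * (u - r n))) =
      fun u => φ (0 + 8 * ((n : ℝ) + 2) ^ 2 * (u - r n)) := by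
    intro n; simp
  refine contDiff_tsum (𝕜 := ℝ) (N := (⊤ : ℕ∞))
    (f := fun (n : ℕ) (u : ℝ) => a n * φ (8 * ((n : ℝ) + 2) ^ 2 * (u - r n)))
    (v := fun k n => (1 / 2) ^ n * ((8 * ((n : ℝ) + 2) ^ 2) ^ k * C k)) ?_ ?_ ?_
  · intro n
    exact contDiff_const.mul (hφ.comp (by fun_prop))
  · intro k _
    have h1 : Summable fun n : ℕ => ((n : ℝ)) ^ (2 * k) * (1 / 2 : ℝ) ^ n :=
      summable_pow_mul_geometric_of_norm_lt_one _ (by norm_num)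
    -- The shift turns `n` into `n + 2`, and the factor 4 cancels the additional `(1 / 2) ^ 2`.
    have h2 := ((summable_nat_add_iff 2).2 h1).mul_left (8 ^ k * C k * 4)
    refine h2.congr fun n => ?_
    push_cast
    rw [mul_pow, ← pow_mul, pow_add]
    ring
  · intro k n x _
    rw [norm_iteratedFDeriv_eq_norm_iteratedDeriv]
    have hcd : ContDiff ℝ k fun u => φ (8 * ((n : ℝ) + 2) ^ 2 * (u - r n)) :=
      (hφ.comp (by fun_prop)).of_le (by exact_mod_cast le_top)
    rw [iteratedDeriv_const_mul _ hcd.contDiffAt, h0, iteratedDeriv_comp_affine hφ, norm_mul, norm_smul]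
    have h3 : ‖(8 * ((n : ℝ) + 2) ^ 2) ^ k‖ = (8 * ((n : ℝ) + 2) ^ 2) ^ k :=
      Real.norm_of_nonneg (by positivity)
    rw [h3]
    have := ha n
    gcongr
    · exact this
    · exact hC k _

/-- The times at which the special curves pass through prescribed points. -/
noncomputable def specialTime (n : ℕ) : ℝ := 1 / ((n : ℝ) + 1)

theorem specialTime_mem (n : ℕ) : specialTime n ∈ Icc (0 : ℝ) 1 := by
  unfold specialTime
  refine ⟨by positivity, ?_⟩
  rw [div_le_one (by positivity)]
  linarith [(Nat.cast_nonneg n : (0 : ℝ) ≤ n)]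

/-- The gap after time `m` is already `1 / ((m + 1) (m + 2))`. Quadratic lower bounds at both ends
allow bumps whose scales grow only polynomially. -/
theorem specialTime_sub_of_lt {m n : ℕ} (h : m < n) :
    1 / ((m : ℝ) + 2) ^ 2 ≤ specialTime m - specialTime n ∧
      1 / ((n : ℝ) + 2) ^ 2 ≤ specialTime m - specialTime n := by
  unfold specialTime
  have hm : (0 : ℝ) ≤ m := Nat.cast_nonneg m
  have hmn : (m : ℝ) + 1 ≤ n := by exact_mod_cast h
  have e : 1 / ((m : ℝ) + 1) - 1 / ((n : ℝ) + 1) = (n - m) / ((m + 1) * (n + 1)) := by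
    field_simp
    ring
  rw [e]
  constructor
  · rw [div_le_div_iff₀ (by positivity) (by positivity)]
    nlinarith [mul_nonneg hm (sub_nonneg.2 hmn)]
  · rw [div_le_div_iff₀ (by positivity) (by positivity)]
    nlinarith [mul_nonneg hm (sub_nonneg.2 hmn)]

theorem specialTime_gap {m n : ℕ} (h : m ≠ n) :
    1 / ((m : ℝ) + 2) ^ 2 ≤ |specialTime m - specialTime n| ∧
      1 / ((n : ℝ) + 2) ^ 2 ≤ |specialTime m - specialTime n| := by
  rcases lt_or_gt_of_ne h with h | h
  · have := specialTime_sub_of_lt h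
    exact ⟨this.1.trans (le_abs_self _), this.2.trans (le_abs_self _)⟩
  · have := specialTime_sub_of_lt h
    rw [abs_sub_comm]
    exact ⟨this.2.trans (le_abs_self _), this.1.trans (le_abs_self _)⟩

/-- There is a smooth curve that passes through prescribed points with prescribed velocities at
the times `specialTime n`, provided the data decay geometrically. -/
theorem exists_special_curve (a v : ℕ → ℝ) (ha : ∀ n, |a n| ≤ (1 / 2) ^ n)
    (hv : ∀ n, |v n| ≤ (1 / 2) ^ n) :
    ∃ c : ℝ → ℝ, ContDiff ℝ ∞ c ∧
      ∀ n, ∀ᶠ u in 𝓝 (specialTime n), c u = a n + v n * (u - specialTime n) := by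
  let χ : ContDiffBump (0 : ℝ) := ⟨1, 2, by norm_num, by norm_num⟩
  have hχ : ContDiff ℝ ∞ (fun x => χ x) := χ.contDiff
  have hχc : HasCompactSupport (fun x => χ x) := χ.hasCompactSupport
  -- The `n`-th bump is 1 within `1 / M n` of its centre and vanishes beyond `2 / M n`, a quarter of
  -- the guaranteed gap. Hence near each centre only one term of the sum is nonzero.
  let M : ℕ → ℝ := fun n => 8 * ((n : ℝ) + 2) ^ 2
  have hM : ∀ n, 0 < M n := fun n => by positivity
  -- The rescaled function `x ↦ x * χ x` has slope `M n` at its centre, so the velocity is divided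
  -- by `M n`.
  let b : ℕ → ℝ := fun n => v n / M n
  have hb : ∀ n, |b n| ≤ (1 / 2) ^ n := by
    intro n
    have h1 : 1 ≤ M n := by
      have : (0 : ℝ) ≤ n := Nat.cast_nonneg n
      simp only [M]; nlinarith
    rw [abs_div, abs_of_pos (hM n)]
    exact (div_le_self (abs_nonneg _) h1).trans (hv n)
  have hψ : ContDiff ℝ ∞ (fun x => x * χ x) := contDiff_id.mul hχ
  have hψc : HasCompactSupport (fun x => x * χ x) := hχc.mul_left
  refine ⟨fun u => (∑' n, a n * χ (M n * (u - specialTime n))) +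
    ∑' n, b n * ((M n * (u - specialTime n)) * χ (M n * (u - specialTime n))),
    (contDiff_tsum_rescaled hχ hχc a _ ha).add (contDiff_tsum_rescaled hψ hψc b _ hb), ?_⟩
  intro n
  have hball : Metric.ball (specialTime n) (1 / M n) ∈ 𝓝 (specialTime n) :=
    Metric.ball_mem_nhds _ (by have := hM n; positivity)
  filter_upwards [hball] with u hu
  rw [Metric.mem_ball, Real.dist_eq] at hu
  have hn : χ (M n * (u - specialTime n)) = 1 := by
    apply χ.one_of_mem_closedBall
    rw [Metric.mem_closedBall, dist_zero_right, Real.norm_eq_abs, abs_mul, abs_of_pos (hM n)]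
    have := (lt_div_iff₀' (hM n)).1 hu
    exact this.le
  have hm : ∀ m, m ≠ n → χ (M m * (u - specialTime m)) = 0 := by
    intro m hmn
    apply χ.zero_of_le_dist
    rw [dist_zero_right, Real.norm_eq_abs, abs_mul, abs_of_pos (hM m)]
    change 2 ≤ _
    obtain ⟨g1, g2⟩ := specialTime_gap hmn
    have h1 : 1 / M n = 1 / ((n : ℝ) + 2) ^ 2 / 8 := by
      simp only [M]; field_simp
    have h2 : |specialTime m - specialTime n| ≤
        |u - specialTime m| + |u - specialTime n| := by
      rw [show specialTime m - specialTime n =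
        -(u - specialTime m) + (u - specialTime n) by ring]
      exact (abs_add_le _ _).trans (by rw [abs_neg])
    have h3 : 1 / ((m : ℝ) + 2) ^ 2 / 4 ≤ |u - specialTime m| := by
      have : 1 / ((m : ℝ) + 2) ^ 2 / 4 ≤ 1 / ((m : ℝ) + 2) ^ 2 / 2 := by
        have : 0 ≤ 1 / ((m : ℝ) + 2) ^ 2 := by positivity
        linarith
      linarith
    calc (2 : ℝ) = M m * (1 / ((m : ℝ) + 2) ^ 2 / 4) := by simp only [M]; field_simp; norm_num
      _ ≤ _ := mul_le_mul_of_nonneg_left h3 (hM m).le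
  rw [tsum_eq_single n fun m h => by rw [hm m h, mul_zero],
    tsum_eq_single n fun m h => by rw [hm m h, mul_zero, mul_zero], hn]
  have := (hM n).ne'
  simp only [b]
  field_simp

/-! ### Functions of two variables that are smooth along curves. -/

/-- A function of two real variables is smooth along curves if its composites with all smooth
curves in the plane are smooth. -/
def CurveSmooth (G : ℝ → ℝ → ℂ) : Prop :=
  ∀ σ τ : ℝ → ℝ, ContDiff ℝ ∞ σ → ContDiff ℝ ∞ τ → ContDiff ℝ ∞ fun u => G (σ u) (τ u)

namespace CurveSmooth

variable {G : ℝ → ℝ → ℂ}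

theorem swap (hG : CurveSmooth G) : CurveSmooth fun s t => G t s :=
  fun σ τ hσ hτ => hG τ σ hτ hσ

theorem left (hG : CurveSmooth G) (t : ℝ) : ContDiff ℝ ∞ fun s => G s t :=
  hG _ _ contDiff_id contDiff_const

/-- The partial derivatives in the first variable are bounded on bounded sets. -/
theorem exists_bound (hG : CurveSmooth G) (p : ℕ) (R : ℝ) :
    ∃ C, ∀ s ∈ Icc (-R) R, ∀ t ∈ Icc (-R) R, ‖iteratedDeriv p (fun s => G s t) s‖ ≤ C := by
  by_contra! hcon
  -- A curve through the bad point with horizontal speed `2 ^ (-n)` multiplies the `p`-th derivative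
  -- by `2 ^ (-n p)`. The threshold is chosen so that a value above `n` remains.
  choose s hs t ht hlt using fun n : ℕ => hcon ((2 : ℝ) ^ (n * p) * n)
  obtain ⟨x, -, φ, hφ, hx⟩ := (isCompact_Icc.prod isCompact_Icc).tendsto_subseq
    (x := fun n => (s n, t n)) fun n => ⟨hs n, ht n⟩
  have hx1 : Tendsto (s ∘ φ) atTop (𝓝 x.1) := (continuous_fst.tendsto x).comp hx
  have hx2 : Tendsto (t ∘ φ) atTop (𝓝 x.2) := (continuous_snd.tendsto x).comp hx
  have hev : ∀ n : ℕ, ∀ᶠ k in atTop, |s (φ k) - x.1| ≤ (1 / 2) ^ n ∧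
      |t (φ k) - x.2| ≤ (1 / 2) ^ n := by
    intro n
    have hpos : (0 : ℝ) < (1 / 2) ^ n := by positivity
    filter_upwards [hx1 (Metric.closedBall_mem_nhds _ hpos),
      hx2 (Metric.closedBall_mem_nhds _ hpos)] with k h1 h2
    exact ⟨h1, h2⟩
  -- A second extraction makes the convergence geometric, as the special curve lemma requires.
  obtain ⟨ψ, hψ, hfast⟩ := extraction_forall_of_eventually hev
  obtain ⟨c₁, hc₁, hc₁'⟩ := exists_special_curve (fun n => s (φ (ψ n)) - x.1)
    (fun n => (1 / 2) ^ n) (fun n => (hfast n).1)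
    (fun n => (abs_of_pos (by positivity)).le)
  -- The second coordinate has velocity 0, so near each special time the composite sees only the
  -- first variable.
  obtain ⟨c₂, hc₂, hc₂'⟩ := exists_special_curve (fun n => t (φ (ψ n)) - x.2) 0
    (fun n => (hfast n).2) (fun n => by simp)
  have hsm := hG (fun u => x.1 + c₁ u) (fun u => x.2 + c₂ u) (contDiff_const.add hc₁)
    (contDiff_const.add hc₂)
  obtain ⟨C, hC⟩ := isCompact_Icc.exists_bound_of_continuousOn (s := Icc (0 : ℝ) 1)
    (hsm.continuous_iteratedDeriv p (by exact_mod_cast le_top)).continuousOn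
  obtain ⟨n, hn⟩ := exists_nat_gt C
  have hCn := hC _ (specialTime_mem n)
  have heq : (fun u => G (x.1 + c₁ u) (x.2 + c₂ u)) =ᶠ[𝓝 (specialTime n)]
      fun u => G (s (φ (ψ n)) + (1 / 2) ^ n * (u - specialTime n)) (t (φ (ψ n))) := by
    filter_upwards [hc₁' n, hc₂' n] with u h1 h2
    rw [h1, h2]
    congr 1
    · ring
    · simp
  rw [heq.iteratedDeriv_eq,
    iteratedDeriv_comp_affine (f := fun s => G s (t (φ (ψ n)))) (hG.left _)] at hCn
  simp only [sub_self, mul_zero, add_zero, norm_smul] at hCn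
  have hle : n ≤ φ (ψ n) := (hψ.id_le n).trans (hφ.id_le _)
  have h4 := hlt (φ (ψ n))
  have h5 : (2 : ℝ) ^ (n * p) * n ≤ (2 : ℝ) ^ (φ (ψ n) * p) * φ (ψ n) := by
    gcongr
    norm_num
  have h6 : ‖((1 / 2 : ℝ) ^ n) ^ p‖ = ((2 : ℝ) ^ (n * p))⁻¹ := by
    rw [Real.norm_of_nonneg (by positivity), ← pow_mul, one_div, inv_pow]
  rw [h6, inv_mul_le_iff₀ (by positivity)] at hCn
  have h7 : (2 : ℝ) ^ (n * p) * C < 2 ^ (n * p) * n := by gcongr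
  linarith

/-- Both first partial derivatives are bounded on boxes, so `G` is locally Lipschitz by the mean
value inequality along a horizontal and a vertical segment. -/
theorem continuous_uncurry (hG : CurveSmooth G) : Continuous (Function.uncurry G) := by
  rw [continuous_iff_continuousAt]
  rintro ⟨s₀, t₀⟩
  set R := max |s₀| |t₀| + 1
  obtain ⟨C, hC⟩ := hG.exists_bound 1 R
  obtain ⟨D, hD⟩ := hG.swap.exists_bound 1 R
  simp only [iteratedDeriv_one] at hC hD
  have hs₀ : s₀ ∈ Icc (-R) R := abs_le.1 ((le_max_left |s₀| |t₀|).trans (lt_add_one _).le)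
  have ht₀ : t₀ ∈ Icc (-R) R := abs_le.1 ((le_max_right |s₀| |t₀|).trans (lt_add_one _).le)
  rw [ContinuousAt, tendsto_iff_norm_sub_tendsto_zero]
  have hlim : Tendsto (fun q : ℝ × ℝ => C * ‖q.1 - s₀‖ + D * ‖q.2 - t₀‖) (𝓝 (s₀, t₀)) (𝓝 0) := by
    have : Continuous fun q : ℝ × ℝ => C * ‖q.1 - s₀‖ + D * ‖q.2 - t₀‖ := by fun_prop
    simpa using this.tendsto (s₀, t₀)
  refine squeeze_zero' (Eventually.of_forall fun _ => norm_nonneg _) ?_ hlim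
  have h1 : ∀ᶠ q : ℝ × ℝ in 𝓝 (s₀, t₀), |q.1| < R :=
    (continuous_fst.abs.tendsto (s₀, t₀)).eventually_lt_const
      (lt_of_le_of_lt (le_max_left _ _) (lt_add_one _))
  have h2 : ∀ᶠ q : ℝ × ℝ in 𝓝 (s₀, t₀), |q.2| < R :=
    (continuous_snd.abs.tendsto (s₀, t₀)).eventually_lt_const
      (lt_of_le_of_lt (le_max_right _ _) (lt_add_one _))
  filter_upwards [h1, h2] with q hq1 hq2
  have hq1' : q.1 ∈ Icc (-R) R := abs_le.1 hq1.le
  have hq2' : q.2 ∈ Icc (-R) R := abs_le.1 hq2.le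
  have e1 : ‖G q.1 q.2 - G s₀ q.2‖ ≤ C * ‖q.1 - s₀‖ :=
    (convex_Icc (-R) R).norm_image_sub_le_of_norm_deriv_le (f := fun s => G s q.2)
      (fun x _ => (hG.left q.2).differentiable (by simp) x) (fun x hx => hC x hx _ hq2') hs₀ hq1'
  have e2 : ‖G s₀ q.2 - G s₀ t₀‖ ≤ D * ‖q.2 - t₀‖ :=
    (convex_Icc (-R) R).norm_image_sub_le_of_norm_deriv_le (f := fun t => G s₀ t)
      (fun x _ => (hG.swap.left s₀).differentiable (by simp) x) (fun x hx => hD x hx _ hs₀) ht₀ hq2'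
  calc ‖Function.uncurry G q - Function.uncurry G (s₀, t₀)‖
      = ‖(G q.1 q.2 - G s₀ q.2) + (G s₀ q.2 - G s₀ t₀)‖ := by simp [Function.uncurry]
    _ ≤ _ := (norm_add_le _ _).trans (add_le_add e1 e2)

end CurveSmooth

theorem ContDiff.of_eq {E F : Type*} [NormedAddCommGroup E] [NormedSpace ℝ E]
    [NormedAddCommGroup F] [NormedSpace ℝ F] {f g : E → F} {n : WithTop ℕ∞}
    (hf : ContDiff ℝ n f) (h : ∀ x, f x = g x) : ContDiff ℝ n g :=
  funext h ▸ hf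

/-! ### Fourier coefficients on the unit interval. -/

/-- The exponential `x ↦ exp (2 π i n x)`. -/
noncomputable def periodExp (n : ℤ) (x : ℝ) : ℂ := Complex.exp (2 * Real.pi * Complex.I * n * x)

theorem norm_periodExp (n : ℤ) (x : ℝ) : ‖periodExp n x‖ = 1 := by
  rw [periodExp, show (2 * Real.pi * Complex.I * n * x : ℂ) = ((2 * Real.pi * n * x : ℝ) : ℂ) *
    Complex.I by push_cast; ring, Complex.norm_exp_ofReal_mul_I]

theorem hasDerivAt_periodExp (n : ℤ) (x : ℝ) :
    HasDerivAt (periodExp n) (2 * Real.pi * Complex.I * n * periodExp n x) x := by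
  have h1 : HasDerivAt (fun y : ℝ => (2 * Real.pi * Complex.I * n * y : ℂ))
      (2 * Real.pi * Complex.I * n) x := by
    simpa using (Complex.ofRealCLM.hasDerivAt (x := x)).const_mul (2 * Real.pi * Complex.I * n : ℂ)
  have h2 := h1.cexp
  rw [mul_comm (Complex.exp _)] at h2
  exact h2

theorem continuous_periodExp (n : ℤ) : Continuous (periodExp n) :=
  continuous_iff_continuousAt.2 fun x => (hasDerivAt_periodExp n x).continuousAt

/-- The Fourier coefficients of the restriction of a function to the unit interval. -/
noncomputable def periodCoeff (f : ℝ → ℂ) (n : ℤ) : ℂ :=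
  ∫ x in (0 : ℝ)..1, periodExp (-n) x * f x

theorem norm_periodCoeff_le {f : ℝ → ℂ} {C : ℝ} (hC : ∀ x ∈ Icc (0 : ℝ) 1, ‖f x‖ ≤ C) (n : ℤ) :
    ‖periodCoeff f n‖ ≤ C := by
  have := intervalIntegral.norm_integral_le_of_norm_le_const (a := (0 : ℝ)) (b := 1) (C := C)
    (f := fun x => periodExp (-n) x * f x) (by
      intro x hx
      rw [uIoc_of_le zero_le_one] at hx
      rw [norm_mul, norm_periodExp, one_mul]
      exact hC x ⟨hx.1.le, hx.2⟩)
  simpa [periodCoeff] using this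

theorem periodCoeff_deriv {f : ℝ → ℂ} (hf : ContDiff ℝ ∞ f) (h0 : f 0 = 0) (h1 : f 1 = 0)
    (n : ℤ) : periodCoeff (deriv f) n = 2 * Real.pi * Complex.I * n * periodCoeff f n := by
  have hd : Continuous (deriv f) := hf.continuous_deriv (by simp)
  have he := continuous_periodExp (-n)
  rw [periodCoeff, intervalIntegral.integral_mul_deriv_eq_deriv_mul
    (u' := fun x => 2 * Real.pi * Complex.I * (-n : ℤ) * periodExp (-n) x)
    (fun x _ => hasDerivAt_periodExp (-n) x)
    (fun x _ => (hf.differentiable (by simp) x).hasDerivAt)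
    ((continuous_const.mul he).intervalIntegrable _ _) (hd.intervalIntegrable _ _), h0, h1,
    periodCoeff]
  simp only [mul_assoc, intervalIntegral.integral_const_mul]
  push_cast
  ring

/-- Vanishing near 0 and 1, and not only at these points, removes the boundary terms of all the
integrations by parts. -/
theorem periodCoeff_iteratedDeriv {f : ℝ → ℂ} (hf : ContDiff ℝ ∞ f) (h0 : f =ᶠ[𝓝 0] 0)
    (h1 : f =ᶠ[𝓝 1] 0) (p : ℕ) (n : ℤ) :
    periodCoeff (iteratedDeriv p f) n = (2 * Real.pi * Complex.I * n) ^ p * periodCoeff f n := by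
  induction p with
  | zero => simp
  | succ p ih =>
    have hp : ContDiff ℝ ∞ (iteratedDeriv p f) := by
      rw [iteratedDeriv_eq_iterate]
      exact hf.iterate_deriv p
    have hz : ∀ x, f =ᶠ[𝓝 x] 0 → iteratedDeriv p f x = 0 := by
      intro x hx
      rw [hx.iteratedDeriv_eq]
      simp [Pi.zero_def]
    rw [iteratedDeriv_succ, periodCoeff_deriv hp (hz 0 h0) (hz 1 h1), ih]
    ring

/-- The weight `1 + |n|` that measures growth and decay of sequences indexed by the integers. -/
noncomputable def intWeight (n : ℤ) : ℝ := 1 + |(n : ℝ)|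

theorem one_le_intWeight (n : ℤ) : 1 ≤ intWeight n := by
  simp [intWeight]

theorem intWeight_pos (n : ℤ) : 0 < intWeight n := zero_lt_one.trans_le (one_le_intWeight n)

theorem summable_intWeight : Summable fun n : ℤ => 1 / intWeight n ^ 2 := by
  have h : Summable fun n : ℕ => 1 / ((n : ℝ) + 1) ^ 2 := by
    have := (summable_nat_add_iff 1).2 (Real.summable_one_div_nat_pow.2 (one_lt_two))
    simpa using this
  refine Summable.of_nat_of_neg ?_ ?_
  · refine h.congr fun n => ?_
    simp [intWeight, add_comm]
  · refine h.congr fun n => ?_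
    simp [intWeight, add_comm]

theorem le_div_intWeight {x C : ℝ} {n : ℤ} (h : intWeight n ^ 2 * x ≤ C) :
    x ≤ C * (1 / intWeight n ^ 2) := by
  rw [mul_one_div, le_div_iff₀' (pow_pos (intWeight_pos n) 2)]
  exact h

theorem summable_of_intWeight_le {E : Type*} [NormedAddCommGroup E] [CompleteSpace E]
    {x : ℤ → E} {C : ℝ} (h : ∀ n, intWeight n ^ 2 * ‖x n‖ ≤ C) : Summable x :=
  .of_norm_bounded (summable_intWeight.mul_left C) fun n => le_div_intWeight (h n)

/-- Decay of Fourier coefficients of smooth functions that vanish near the ends. -/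
theorem exists_periodCoeff_le {p : ℕ} {C D : ℝ} :
    ∃ B, ∀ f : ℝ → ℂ, ContDiff ℝ ∞ f → f =ᶠ[𝓝 0] 0 → f =ᶠ[𝓝 1] 0 →
      (∀ x ∈ Icc (0 : ℝ) 1, ‖f x‖ ≤ C) →
      (∀ x ∈ Icc (0 : ℝ) 1, ‖iteratedDeriv p f x‖ ≤ D) →
      ∀ n, intWeight n ^ p * ‖periodCoeff f n‖ ≤ B := by
  -- `(1 + |n|) ^ p` is at most `2 ^ p (1 + |n| ^ p)`; the bound on `f` pays for the summand 1 and
  -- the bound on its `p`-th derivative for `|n| ^ p`.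
  refine ⟨2 ^ p * (C + D), fun f hf h0 h1 hC hD n => ?_⟩
  have e1 := norm_periodCoeff_le hC n
  have e2 := norm_periodCoeff_le hD n
  rw [periodCoeff_iteratedDeriv hf h0 h1, norm_mul, norm_pow] at e2
  have e3 : |(n : ℝ)| ≤ ‖(2 * Real.pi * Complex.I * n : ℂ)‖ := by
    simp only [norm_mul, Complex.norm_I, Complex.norm_real, Complex.norm_ofNat,
      Complex.norm_intCast, mul_one, Real.norm_eq_abs, abs_of_pos Real.pi_pos]
    nlinarith [Real.pi_gt_three, abs_nonneg (n : ℝ)]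
  have e4 : |(n : ℝ)| ^ p * ‖periodCoeff f n‖ ≤ D := by
    refine le_trans ?_ e2
    gcongr
  have e5 : intWeight n ^ p ≤ 2 ^ p * (1 + |(n : ℝ)| ^ p) := by
    have h2 : intWeight n ≤ 2 * max 1 |(n : ℝ)| := by
      rw [intWeight]; linarith [le_max_left 1 |(n : ℝ)|, le_max_right 1 |(n : ℝ)|]
    calc intWeight n ^ p ≤ (2 * max 1 |(n : ℝ)|) ^ p :=
          pow_le_pow_left₀ (intWeight_pos n).le h2 p
      _ = 2 ^ p * (max 1 |(n : ℝ)|) ^ p := mul_pow _ _ _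
      _ ≤ _ := by
        gcongr
        rcases max_cases 1 |(n : ℝ)| with ⟨h, -⟩ | ⟨h, -⟩ <;> rw [h]
        · simp
        · simp
  calc intWeight n ^ p * ‖periodCoeff f n‖
      ≤ 2 ^ p * (1 + |(n : ℝ)| ^ p) * ‖periodCoeff f n‖ := by gcongr
    _ = 2 ^ p * (‖periodCoeff f n‖ + |(n : ℝ)| ^ p * ‖periodCoeff f n‖) := by ring
    _ ≤ _ := by gcongr

/-- Fourier inversion on the unit interval. -/
theorem hasSum_periodCoeff {f : ℝ → ℂ} (hf : Continuous f) (h : f 0 = f 1)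
    (hs : Summable (periodCoeff f)) {x : ℝ} (hx : x ∈ Ico (0 : ℝ) 1) :
    HasSum (fun n => periodCoeff f n * periodExp n x) (f x) := by
  have : Fact ((0 : ℝ) < 1) := ⟨zero_lt_one⟩
  have hcont : Continuous (AddCircle.liftIco (1 : ℝ) 0 f) :=
    AddCircle.liftIco_continuous (by simpa using h) hf.continuousOn
  have hexp : ∀ (n : ℤ) (y : ℝ), fourier n (y : AddCircle (1 : ℝ)) = periodExp n y := by
    intro n y
    rw [fourier_coe_apply, periodExp]
    simp
  have hco : ∀ n, fourierCoeff (AddCircle.liftIco (1 : ℝ) 0 f) n = periodCoeff f n := by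
    intro n
    rw [fourierCoeff_eq_intervalIntegral _ n 0, periodCoeff]
    simp only [zero_add, div_one, one_smul, smul_eq_mul]
    rw [intervalIntegral.integral_of_le zero_le_one, intervalIntegral.integral_of_le zero_le_one,
      MeasureTheory.integral_Ioc_eq_integral_Ioo, MeasureTheory.integral_Ioc_eq_integral_Ioo]
    refine MeasureTheory.setIntegral_congr_fun measurableSet_Ioo fun y hy => ?_
    simp only [hexp]
    rw [AddCircle.liftIco_coe_apply (by simpa using ⟨hy.1.le, hy.2⟩)]
  have key := has_pointwise_sum_fourier_series_of_summable
    (f := (⟨_, hcont⟩ : C(AddCircle (1 : ℝ), ℂ))) (by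
      refine hs.congr fun n => (hco n).symm) (x : AddCircle (1 : ℝ))
  simp only [ContinuousMap.coe_mk, hco, hexp, smul_eq_mul] at key
  rwa [AddCircle.liftIco_coe_apply (by simpa using hx)] at key

/-! ### Uniform boundedness and families with rapid decay. -/

/-- Uniform boundedness for families of summable sequences: if all pairings with bounded sequences
are bounded, then so are the entries. -/
theorem exists_bound_of_tsum_bounded {ι : Type*} (x : ι → ℤ → ℂ)
    (hx : ∀ i, Summable fun n => ‖x i n‖)
    (h : ∀ b : ℤ → ℂ, (∃ K, ∀ n, ‖b n‖ ≤ K) → ∃ C, ∀ i, ‖∑' n, b n * x i n‖ ≤ C) :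
    ∃ C, ∀ i n, ‖x i n‖ ≤ C := by
  have hsum : ∀ i (b : BoundedContinuousFunction ℤ ℂ), Summable fun n => b n * x i n := by
    intro i b
    refine .of_norm_bounded ((hx i).mul_left ‖b‖) fun n => ?_
    rw [norm_mul]
    exact mul_le_mul_of_nonneg_right (b.norm_coe_le_norm n) (norm_nonneg _)
  -- Each sequence `x i` acts on the Banach space of bounded sequences by pairing; the unit
  -- sequences recover its entries from the functional.
  let g : ι → BoundedContinuousFunction ℤ ℂ →L[ℂ] ℂ := fun i =>
    LinearMap.mkContinuous
      { toFun := fun b => ∑' n, b n * x i n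
        map_add' := fun b b' => by
          rw [← (hsum i b).tsum_add (hsum i b')]
          simp [add_mul]
        map_smul' := fun c b => by
          simp [mul_assoc, tsum_mul_left] }
      (∑' n, ‖x i n‖) (fun b => by
        have h1 : Summable fun n => ‖b n * x i n‖ := (hsum i b).norm
        refine (norm_tsum_le_tsum_norm h1).trans ?_
        rw [← tsum_mul_right]
        refine h1.tsum_le_tsum (fun n => ?_) ((hx i).mul_right _)
        rw [norm_mul, mul_comm]
        exact mul_le_mul_of_nonneg_left (b.norm_coe_le_norm n) (norm_nonneg _))
  obtain ⟨C, hC⟩ := banach_steinhaus (g := g) fun b => h b ⟨‖b‖, b.norm_coe_le_norm⟩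
  refine ⟨C, fun i n => ?_⟩
  let b : BoundedContinuousFunction ℤ ℂ := BoundedContinuousFunction.ofNormedAddCommGroupDiscrete
    (Pi.single n 1) 1 fun m => by
      by_cases hm : m = n
      · subst hm; simp
      · simp [hm]
  have hb : ‖b‖ ≤ 1 := (BoundedContinuousFunction.norm_le zero_le_one).2 fun m => by
    by_cases hm : m = n
    · subst hm; simp [b]
    · simp [b, hm]
  have hgb : g i b = x i n := by
    change ∑' m, b m * x i m = x i n
    rw [tsum_eq_single n fun m hm => by simp [b, hm]]
    simp [b]
  rw [← hgb]
  exact ((g i).le_of_opNorm_le (hC i) b).trans (mul_le_of_le_one_right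
    ((norm_nonneg _).trans (hC i)) hb)

/-- Sequences of at most polynomial growth. -/
def PolyGrowth (a : ℤ → ℂ) : Prop := ∃ (p : ℕ) (K : ℝ), ∀ n, ‖a n‖ ≤ K * intWeight n ^ p

theorem PolyGrowth.mul {a b : ℤ → ℂ} (ha : PolyGrowth a) (hb : PolyGrowth b) :
    PolyGrowth fun n => a n * b n := by
  obtain ⟨p, K, h⟩ := ha
  obtain ⟨q, K', h'⟩ := hb
  refine ⟨p + q, K * K', fun n => ?_⟩
  rw [norm_mul, pow_add, mul_mul_mul_comm]
  exact mul_le_mul (h n) (h' n) (norm_nonneg _) ((norm_nonneg _).trans (h n))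

theorem PolyGrowth.of_bounded {a : ℤ → ℂ} (h : ∃ K, ∀ n, ‖a n‖ ≤ K) : PolyGrowth a := by
  obtain ⟨K, h⟩ := h
  exact ⟨0, K, fun n => by simpa using h n⟩

theorem PolyGrowth.intWeight_pow (p : ℕ) : PolyGrowth fun n => (intWeight n : ℂ) ^ p :=
  ⟨p, 1, fun n => by simp [abs_of_pos (intWeight_pos n)]⟩

theorem PolyGrowth.single (n : ℤ) : PolyGrowth (Pi.single n 1) :=
  .of_bounded ⟨1, fun m => by
    by_cases hm : m = n
    · subst hm; simp
    · simp [hm]⟩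

theorem PolyGrowth.linear (c : ℂ) : PolyGrowth fun n => c * n := by
  refine ⟨1, ‖c‖, fun n => ?_⟩
  rw [norm_mul, Complex.norm_intCast, pow_one]
  gcongr
  simp [intWeight]

/-- Polynomial growth is paid for by a higher power of the weight. The index `ι` keeps the bound
uniform over a parameter such as time. -/
theorem PolyGrowth.exists_bound_mul {a : ℤ → ℂ} (ha : PolyGrowth a) {ι : Type*} (x : ι → ℤ → ℂ)
    (hx : ∀ p : ℕ, ∃ C, ∀ i n, intWeight n ^ p * ‖x i n‖ ≤ C) (p : ℕ) :
    ∃ C, ∀ i n, intWeight n ^ p * ‖a n * x i n‖ ≤ C := by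
  obtain ⟨q, K, h⟩ := ha
  obtain ⟨C, hC⟩ := hx (p + q)
  have hK : 0 ≤ K := by
    have := (norm_nonneg _).trans (h 0)
    simpa [intWeight] using this
  refine ⟨K * C, fun i n => ?_⟩
  have hw := intWeight_pos n
  calc intWeight n ^ p * ‖a n * x i n‖ = ‖a n‖ * (intWeight n ^ p * ‖x i n‖) := by
        rw [norm_mul]; ring
    _ ≤ K * intWeight n ^ q * (intWeight n ^ p * ‖x i n‖) := by
        gcongr
        exact h n
    _ = K * (intWeight n ^ (p + q) * ‖x i n‖) := by rw [pow_add]; ring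
    _ ≤ K * C := by gcongr; exact hC i n

/-- Families of functions all of whose combinations with coefficients of polynomial growth are
smooth. -/
structure RapidSmooth (h : ℤ → ℝ → ℂ) : Prop where
  bounded : ∀ (p : ℕ) (t : ℝ), ∃ C, ∀ n, intWeight n ^ p * ‖h n t‖ ≤ C
  smooth : ∀ a : ℤ → ℂ, PolyGrowth a → ContDiff ℝ ∞ fun t => ∑' n, a n * h n t

namespace RapidSmooth

variable {h : ℤ → ℝ → ℂ}

theorem summable (hh : RapidSmooth h) {a : ℤ → ℂ} (ha : PolyGrowth a) (t : ℝ) :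
    Summable fun n => a n * h n t := by
  obtain ⟨C, hC⟩ := ha.exists_bound_mul (ι := Unit) (fun _ n => h n t)
    (fun p => (hh.bounded p t).imp fun C hC _ n => hC n) 2
  exact summable_of_intWeight_le (hC ())

theorem contDiff (hh : RapidSmooth h) (n : ℤ) : ContDiff ℝ ∞ (h n) := by
  have := hh.smooth _ (PolyGrowth.single n)
  refine ContDiff.of_eq this fun t => ?_
  rw [tsum_eq_single n fun m hm => by simp [hm]]
  simp

theorem mul (hh : RapidSmooth h) {a : ℤ → ℂ} (ha : PolyGrowth a) :
    RapidSmooth fun n t => a n * h n t where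
  bounded p t := by
    obtain ⟨C, hC⟩ := ha.exists_bound_mul (ι := Unit) (fun _ n => h n t)
      (fun p => (hh.bounded p t).imp fun C hC _ n => hC n) p
    exact ⟨C, hC ()⟩
  smooth b hb := by
    refine ContDiff.of_eq (hh.smooth _ (hb.mul ha)) fun t => ?_
    simp only [mul_assoc]

theorem add {k : ℤ → ℝ → ℂ} (hh : RapidSmooth h) (hk : RapidSmooth k) :
    RapidSmooth fun n t => h n t + k n t where
  bounded p t := by
    obtain ⟨C, hC⟩ := hh.bounded p t
    obtain ⟨D, hD⟩ := hk.bounded p t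
    refine ⟨C + D, fun n => ?_⟩
    have := norm_add_le (h n t) (k n t)
    have hw := pow_pos (intWeight_pos n) p
    nlinarith [hC n, hD n]
  smooth a ha := by
    refine ContDiff.of_eq ((hh.smooth a ha).add (hk.smooth a ha)) fun t => ?_
    rw [← (hh.summable ha t).tsum_add (hk.summable ha t)]
    simp only [mul_add]

theorem const {k : ℤ → ℂ} (hk : ∀ p : ℕ, ∃ C, ∀ n, intWeight n ^ p * ‖k n‖ ≤ C) :
    RapidSmooth fun n _ => k n where
  bounded p _ := hk p
  smooth _ _ := contDiff_const

/-- For bounded `b` the function `∑ b n * intWeight n ^ p * h n` is continuously differentiable, so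
its difference quotients on `[-R, R]` are bounded. The uniform boundedness principle over all pairs
of distinct times makes the bound uniform in `n`. -/
theorem exists_lipschitz (hh : RapidSmooth h) (p : ℕ) (R : ℝ) :
    ∃ C, ∀ n, ∀ t ∈ Icc (-R) R, ∀ t' ∈ Icc (-R) R,
      intWeight n ^ p * ‖h n t - h n t'‖ ≤ C * ‖t - t'‖ := by
  let ι := {q : ℝ × ℝ // q.1 ∈ Icc (-R) R ∧ q.2 ∈ Icc (-R) R ∧ q.1 ≠ q.2}
  have hw := hh.mul (PolyGrowth.intWeight_pow p)
  have hsum : ∀ {b : ℤ → ℂ}, PolyGrowth b → ∀ t,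
      Summable fun n => b n * ((intWeight n : ℂ) ^ p * h n t) := fun hb t => hw.summable hb t
  have hdiff : ∀ t t', Summable fun n =>
      ‖(intWeight n : ℂ) ^ p * h n t - (intWeight n : ℂ) ^ p * h n t'‖ := fun t t' => by
    have h1 := hsum (b := fun _ => 1) (.of_bounded ⟨1, by simp⟩)
    simpa only [one_mul] using ((h1 t).sub (h1 t')).norm
  obtain ⟨C, hC⟩ := exists_bound_of_tsum_bounded
    (fun (i : ι) n => (((i.1.1 - i.1.2 : ℝ))⁻¹ : ℂ) *
      ((intWeight n : ℂ) ^ p * h n i.1.1 - (intWeight n : ℂ) ^ p * h n i.1.2))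
    (fun i => by
      simp only [norm_mul]
      exact (hdiff _ _).mul_left _)
    (fun b hb => by
      have hb' := PolyGrowth.of_bounded hb
      have hF := hw.smooth b hb'
      obtain ⟨C, hC⟩ := isCompact_Icc.exists_bound_of_continuousOn (s := Icc (-R) R)
        (hF.continuous_deriv (by simp)).continuousOn
      refine ⟨C, fun i => ?_⟩
      obtain ⟨⟨t, t'⟩, ht, ht', hne⟩ := i
      have h1 := (convex_Icc (-R) R).norm_image_sub_le_of_norm_deriv_le
        (fun x _ => hF.differentiable (by simp) x) hC ht' ht
      rw [← (hsum hb' t).tsum_sub (hsum hb' t')] at h1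
      have h2 : ∑' n, b n * ((((t - t' : ℝ))⁻¹ : ℂ) *
          ((intWeight n : ℂ) ^ p * h n t - (intWeight n : ℂ) ^ p * h n t')) =
          (((t - t' : ℝ))⁻¹ : ℂ) * ∑' n, (b n * ((intWeight n : ℂ) ^ p * h n t) -
            b n * ((intWeight n : ℂ) ^ p * h n t')) := by
        rw [← tsum_mul_left]
        exact tsum_congr fun n => by ring
      simp only
      rw [h2, norm_mul, norm_inv, Complex.norm_real, inv_mul_le_iff₀, mul_comm]
      · exact h1
      · exact norm_pos_iff.2 (sub_ne_zero.2 hne))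
  refine ⟨C, fun n t ht t' ht' => ?_⟩
  by_cases hne : t = t'
  · simp [hne]
  have h1 := hC ⟨(t, t'), ht, ht', hne⟩ n
  simp only at h1
  rw [← mul_sub, norm_mul, norm_inv, Complex.norm_real, norm_mul, norm_pow, Complex.norm_real,
    Real.norm_of_nonneg (intWeight_pos n).le,
    inv_mul_le_iff₀ (norm_pos_iff.2 (sub_ne_zero.2 hne)), mul_comm ‖t - t'‖] at h1
  exact h1

theorem exists_bound (hh : RapidSmooth h) (p : ℕ) (R : ℝ) :
    ∃ C, ∀ n, ∀ t ∈ Icc (-R) R, intWeight n ^ p * ‖h n t‖ ≤ C := by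
  obtain ⟨C, hC⟩ := hh.exists_lipschitz p R
  obtain ⟨D, hD⟩ := hh.bounded p 0
  refine ⟨|C| * R + D, fun n t ht => ?_⟩
  have hR : 0 ≤ R := by linarith [ht.1.trans ht.2]
  have h1 := hC n t ht 0 ⟨by linarith, hR⟩
  have h2 : ‖h n t‖ ≤ ‖h n t - h n 0‖ + ‖h n 0‖ := by
    simpa using norm_add_le (h n t - h n 0) (h n 0)
  have h3 : C * ‖t - 0‖ ≤ |C| * R := by
    rw [sub_zero]
    exact mul_le_mul (le_abs_self C) (abs_le.2 ht) (norm_nonneg _) (abs_nonneg C)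
  have hw := pow_pos (intWeight_pos n) p
  nlinarith [hD n]

theorem exists_bound_deriv (hh : RapidSmooth h) (p : ℕ) (R : ℝ) :
    ∃ C, ∀ n, ∀ t ∈ Ioo (-R) R, intWeight n ^ p * ‖deriv (h n) t‖ ≤ C := by
  obtain ⟨C, hC⟩ := hh.exists_lipschitz p R
  refine ⟨|C|, fun n t ht => ?_⟩
  have hw := pow_pos (intWeight_pos n) p
  rw [← le_div_iff₀' hw]
  refine norm_deriv_le_of_lip' (by positivity) ?_
  filter_upwards [Icc_mem_nhds ht.1 ht.2] with t' ht'
  rw [div_mul_eq_mul_div, le_div_iff₀' hw]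
  exact (hC n t' ht' t ⟨ht.1.le, ht.2.le⟩).trans
    (mul_le_mul_of_nonneg_right (le_abs_self C) (norm_nonneg _))

theorem hasDerivAt_tsum (hh : RapidSmooth h) {a : ℤ → ℂ} (ha : PolyGrowth a) (t : ℝ) :
    HasDerivAt (fun t => ∑' n, a n * h n t) (∑' n, a n * deriv (h n) t) t := by
  set R := |t| + 1
  have ht : t ∈ Ioo (-R) R := abs_lt.1 (lt_add_one _)
  obtain ⟨C, hC⟩ := ha.exists_bound_mul (ι := Ioo (-R) R) (fun t n => deriv (h n) t)
    (fun p => (hh.exists_bound_deriv p R).imp fun C hC i n => hC n i i.2) 2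
  refine hasDerivAt_tsum_of_isPreconnected (t := Ioo (-R) R)
    (summable_intWeight.mul_left C) isOpen_Ioo isPreconnected_Ioo
    (fun n y _ => (((hh.contDiff n).differentiable (by simp) y).hasDerivAt).const_mul (a n))
    (fun n y hy => ?_) ht (hh.summable ha t) ht
  exact le_div_intWeight (hC ⟨y, hy⟩ n)

/-- The decay of the derivatives is the Lipschitz bound, and termwise differentiation identifies
their combinations with derivatives of smooth functions. -/
theorem deriv (hh : RapidSmooth h) : RapidSmooth fun n => deriv (h n) where
  bounded p t := by
    obtain ⟨C, hC⟩ := hh.exists_bound_deriv p (|t| + 1)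
    exact ⟨C, fun n => hC n t (abs_lt.1 (lt_add_one _))⟩
  smooth a ha := by
    have h1 := (contDiff_infty_iff_deriv.1 (hh.smooth a ha)).2
    exact ContDiff.of_eq h1 fun t => (hh.hasDerivAt_tsum ha t).deriv

/-- The derivative has the same shape, with the family `h n' + 2 π i n h n`, which is again
`RapidSmooth`. This closure drives the induction that proves smoothness. -/
theorem hasDerivAt_tsum_mul_periodExp (hh : RapidSmooth h) (t : ℝ) :
    HasDerivAt (fun t => ∑' n, h n t * periodExp n t)
      (∑' n, (_root_.deriv (h n) t + 2 * Real.pi * Complex.I * n * h n t) * periodExp n t) t := by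
  set R := |t| + 1
  have ht : t ∈ Ioo (-R) R := abs_lt.1 (lt_add_one _)
  obtain ⟨C, hC⟩ := (hh.deriv.add (hh.mul (.linear (2 * Real.pi * Complex.I)))).exists_bound 2 R
  obtain ⟨D, hD⟩ := hh.exists_bound 2 R
  refine hasDerivAt_tsum_of_isPreconnected (t := Ioo (-R) R)
    (g := fun n t => h n t * periodExp n t)
    (g' := fun n t => (_root_.deriv (h n) t + 2 * Real.pi * Complex.I * n * h n t) *
      periodExp n t)
    (summable_intWeight.mul_left C) isOpen_Ioo isPreconnected_Ioo
    (fun n y _ => ?_) (fun n y hy => ?_) ht ?_ ht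
  · have h1 := (((hh.contDiff n).differentiable (by simp) y).hasDerivAt).mul
      (hasDerivAt_periodExp n y)
    rwa [show _root_.deriv (h n) y * periodExp n y +
      h n y * (2 * Real.pi * Complex.I * n * periodExp n y) =
      (_root_.deriv (h n) y + 2 * Real.pi * Complex.I * n * h n y) * periodExp n y by ring] at h1
  · rw [norm_mul, norm_periodExp, mul_one]
    exact le_div_intWeight (hC n y ⟨hy.1.le, hy.2.le⟩)
  · refine summable_of_intWeight_le (C := D) fun n => ?_
    rw [norm_mul, norm_periodExp, mul_one]
    exact hD n t ⟨ht.1.le, ht.2.le⟩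

theorem contDiff_tsum_mul_periodExp (hh : RapidSmooth h) :
    ContDiff ℝ ∞ fun t => ∑' n, h n t * periodExp n t := by
  rw [contDiff_infty]
  intro k
  induction k generalizing h with
  | zero =>
    exact contDiff_zero.2 (continuous_iff_continuousAt.2 fun t =>
      (hh.hasDerivAt_tsum_mul_periodExp t).continuousAt)
  | succ k ih =>
    push_cast
    rw [contDiff_succ_iff_deriv]
    refine ⟨fun t => (hh.hasDerivAt_tsum_mul_periodExp t).differentiableAt, by simp, ?_⟩
    refine ContDiff.of_eq (ih (hh.deriv.add (hh.mul (.linear (2 * Real.pi * Complex.I))))) fun t => ?_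
    exact (hh.hasDerivAt_tsum_mul_periodExp t).deriv.symm

end RapidSmooth

/-! ### Cut-offs and double Fourier series. -/

/-- A bump function around the midpoint of the unit interval. -/
noncomputable def midBump : ContDiffBump (1 / 2 : ℝ) := ⟨1 / 8, 1 / 4, by norm_num, by norm_num⟩

theorem midBump_eq_zero {x : ℝ} (hx : 1 / 4 ≤ |x - 1 / 2|) : midBump x = 0 :=
  midBump.zero_of_le_dist (by rw [Real.dist_eq]; exact hx)

theorem midBump_eventually_one : ∀ᶠ x in 𝓝 (1 / 2 : ℝ), midBump x = 1 :=
  midBump.eventuallyEq_one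

theorem eventually_far_zero : ∀ᶠ x in 𝓝 (0 : ℝ), 1 / 4 ≤ |x - 1 / 2| := by
  filter_upwards [Iio_mem_nhds (show (0 : ℝ) < 1 / 4 by norm_num)] with x hx
  rw [abs_of_neg (by linarith [mem_Iio.1 hx])]
  linarith [mem_Iio.1 hx]

theorem eventually_far_one : ∀ᶠ x in 𝓝 (1 : ℝ), 1 / 4 ≤ |x - 1 / 2| := by
  filter_upwards [Ioi_mem_nhds (show (3 / 4 : ℝ) < 1 by norm_num)] with x hx
  rw [abs_of_pos (by linarith [mem_Ioi.1 hx])]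
  linarith [mem_Ioi.1 hx]

theorem contDiff_midBump : ContDiff ℝ ∞ fun x : ℝ => (midBump x : ℂ) :=
  Complex.ofRealCLM.contDiff.comp midBump.contDiff

namespace CurveSmooth

variable {G : ℝ → ℝ → ℂ}

theorem exists_periodCoeff_le (hG : CurveSmooth G)
    (hs : ∀ s t, 1 / 4 ≤ |s - 1 / 2| → G s t = 0) (p : ℕ) :
    ∃ B, ∀ t ∈ Icc (0 : ℝ) 1, ∀ n, intWeight n ^ p * ‖periodCoeff (fun s => G s t) n‖ ≤ B := by
  have hsub : ∀ {x : ℝ}, x ∈ Icc (0 : ℝ) 1 → x ∈ Icc (-1 : ℝ) 1 :=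
    fun hx => ⟨by linarith [hx.1], hx.2⟩
  obtain ⟨C, hC⟩ := hG.exists_bound 0 1
  obtain ⟨D, hD⟩ := hG.exists_bound p 1
  obtain ⟨B, hB⟩ := _root_.exists_periodCoeff_le (p := p) (C := C) (D := D)
  refine ⟨B, fun t ht => hB _ (hG.left t) ?_ ?_ (fun x hx => ?_) (fun x hx => ?_)⟩
  · filter_upwards [eventually_far_zero] with s h using hs s t h
  · filter_upwards [eventually_far_one] with s h using hs s t h
  · simpa using hC x (hsub hx) t (hsub ht)
  · exact hD x (hsub hx) t (hsub ht)

theorem continuous_periodCoeff (hG : CurveSmooth G) (n : ℤ) :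
    Continuous fun t => periodCoeff (fun s => G s t) n := by
  refine intervalIntegral.continuous_parametric_intervalIntegral_of_continuous' ?_ 0 1
  exact ((continuous_periodExp (-n)).comp continuous_snd).mul
    (hG.continuous_uncurry.comp (continuous_snd.prodMk continuous_fst))

theorem periodCoeff_swap (hG : CurveSmooth G) (n m : ℤ) :
    periodCoeff (fun t => periodCoeff (fun s => G s t) n) m =
      periodCoeff (fun s => periodCoeff (fun t => G s t) m) n := by
  simp only [periodCoeff, ← intervalIntegral.integral_const_mul]
  rw [MeasureTheory.intervalIntegral_intervalIntegral_swap]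
  · refine intervalIntegral.integral_congr fun s _ =>
      intervalIntegral.integral_congr fun t _ => ?_
    ring
  · have hcont : Continuous (Function.uncurry fun t s =>
        periodExp (-m) t * (periodExp (-n) s * G s t)) :=
      ((continuous_periodExp (-m)).comp continuous_fst).mul
        (((continuous_periodExp (-n)).comp continuous_snd).mul
          (hG.continuous_uncurry.comp (continuous_snd.prodMk continuous_fst)))
    exact (hcont.continuousOn.integrableOn_compact
      (isCompact_uIcc.prod isCompact_uIcc)).mono_set
        (prod_mono uIoc_subset_uIcc uIoc_subset_uIcc)

/-- The double Fourier coefficients of a function that is smooth along curves decay rapidly. -/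
theorem exists_double_periodCoeff_le (hG : CurveSmooth G)
    (hs : ∀ s t, 1 / 4 ≤ |s - 1 / 2| → G s t = 0) (ht : ∀ s t, 1 / 4 ≤ |t - 1 / 2| → G s t = 0)
    (p q : ℕ) : ∃ B, ∀ n m, intWeight n ^ p * intWeight m ^ q *
      ‖periodCoeff (fun t => periodCoeff (fun s => G s t) n) m‖ ≤ B := by
  -- Doubled exponents give decay in each index separately; `x y ≤ x ^ 2 + y ^ 2` combines the two
  -- into a mixed bound, so no mixed partial derivatives have to be estimated.
  obtain ⟨B, hB⟩ := hG.exists_periodCoeff_le hs (p * 2)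
  obtain ⟨B', hB'⟩ := hG.swap.exists_periodCoeff_le (fun s t h => ht t s h) (q * 2)
  refine ⟨B + B', fun n m => ?_⟩
  have hb : intWeight n ^ (p * 2) *
      ‖periodCoeff (fun t => periodCoeff (fun s => G s t) n) m‖ ≤ B := by
    have hw := pow_pos (intWeight_pos n) (p * 2)
    rw [← le_div_iff₀' hw]
    refine norm_periodCoeff_le (fun t ht => ?_) m
    rw [le_div_iff₀' hw]
    exact hB t ht n
  have hb' : intWeight m ^ (q * 2) *
      ‖periodCoeff (fun t => periodCoeff (fun s => G s t) n) m‖ ≤ B' := by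
    have hw := pow_pos (intWeight_pos m) (q * 2)
    rw [hG.periodCoeff_swap, ← le_div_iff₀' hw]
    refine norm_periodCoeff_le (fun t ht => ?_) n
    rw [le_div_iff₀' hw]
    exact hB' t ht m
  have h1 : intWeight n ^ p * intWeight m ^ q ≤
      intWeight n ^ (p * 2) + intWeight m ^ (q * 2) := by
    rw [pow_mul, pow_mul]
    nlinarith [sq_nonneg (intWeight n ^ p - intWeight m ^ q), sq_nonneg (intWeight n ^ p),
      sq_nonneg (intWeight m ^ q)]
  refine (mul_le_mul_of_nonneg_right h1 (norm_nonneg _)).trans ?_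
  rw [add_mul]
  exact add_le_add hb hb'

end CurveSmooth

section

variable {c : ℤ → ℤ → ℂ}

/-- Of the exponent `2 + r` in `n`, the part `r` absorbs the growth of `a` and the part 2 leaves a
summable majorant. -/
theorem PolyGrowth.exists_double_bound {a : ℤ → ℂ} (ha : PolyGrowth a)
    (hc : ∀ p q : ℕ, ∃ B, ∀ n m, intWeight n ^ p * intWeight m ^ q * ‖c n m‖ ≤ B) (q : ℕ) :
    ∃ B, ∀ n m, intWeight m ^ q * ‖a n * c n m‖ ≤ B * (1 / intWeight n ^ 2) := by
  obtain ⟨r, K, hK⟩ := ha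
  obtain ⟨B, hB⟩ := hc (2 + r) q
  have hK0 : 0 ≤ K := by
    have := (norm_nonneg _).trans (hK 0)
    simpa [intWeight] using this
  refine ⟨K * B, fun n m => le_div_intWeight ?_⟩
  have hn := intWeight_pos n
  have hm := intWeight_pos m
  rw [norm_mul]
  calc _ ≤ intWeight n ^ 2 * (intWeight m ^ q * (K * intWeight n ^ r * ‖c n m‖)) := by
        gcongr
        exact hK n
    _ = K * (intWeight n ^ (2 + r) * intWeight m ^ q * ‖c n m‖) := by rw [pow_add]; ring
    _ ≤ K * B := by gcongr; exact hB n m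

theorem PolyGrowth.exists_tsum_bound {a : ℤ → ℂ} (ha : PolyGrowth a)
    (hc : ∀ p q : ℕ, ∃ B, ∀ n m, intWeight n ^ p * intWeight m ^ q * ‖c n m‖ ≤ B) (q : ℕ) :
    ∃ C, ∀ m, intWeight m ^ q * ‖∑' n, a n * c n m‖ ≤ C := by
  obtain ⟨B, hB⟩ := ha.exists_double_bound hc q
  refine ⟨∑' n : ℤ, B * (1 / intWeight n ^ 2), fun m => ?_⟩
  have hw := pow_pos (intWeight_pos m) q
  have h1 : Summable fun n => intWeight m ^ q * ‖a n * c n m‖ :=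
    .of_nonneg_of_le (fun n => by positivity) (fun n => hB n m) (summable_intWeight.mul_left B)
  have h2 : Summable fun n => ‖a n * c n m‖ := (summable_mul_left_iff hw.ne').1 h1
  refine (mul_le_mul_of_nonneg_left (norm_tsum_le_tsum_norm h2) hw.le).trans ?_
  rw [← tsum_mul_left]
  exact h1.tsum_le_tsum (fun n => hB n m) (summable_intWeight.mul_left B)

theorem PolyGrowth.tsum_comm_periodExp {a : ℤ → ℂ} (ha : PolyGrowth a)
    (hc : ∀ p q : ℕ, ∃ B, ∀ n m, intWeight n ^ p * intWeight m ^ q * ‖c n m‖ ≤ B) (t : ℝ) :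
    ∑' n, a n * ∑' m, c n m * periodExp m t = ∑' m, (∑' n, a n * c n m) * periodExp m t := by
  have hsum : Summable (Function.uncurry fun n m : ℤ => a n * c n m * periodExp m t) := by
    obtain ⟨B, hB⟩ := ha.exists_double_bound hc 2
    have hp := (summable_intWeight.mul_of_nonneg summable_intWeight
      (fun n => (one_div_pos.2 (pow_pos (intWeight_pos n) 2)).le)
      (fun n => (one_div_pos.2 (pow_pos (intWeight_pos n) 2)).le)).mul_left B
    refine .of_norm_bounded hp fun q => ?_
    simp only [Function.uncurry]
    rw [norm_mul, norm_periodExp, mul_one, ← mul_assoc]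
    exact le_div_intWeight (hB q.1 q.2)
  calc _ = ∑' n, ∑' m, a n * c n m * periodExp m t := by
        simp only [← tsum_mul_left, mul_assoc]
    _ = ∑' m, ∑' n, a n * c n m * periodExp m t := hsum.tsum_comm.symm
    _ = _ := tsum_congr fun m => tsum_mul_right

end

/-- The Fourier coefficients in the first variable of a function that is smooth along curves
depend smoothly on the second variable, with rapid decay. -/
theorem CurveSmooth.exists_tsum_periodCoeff_eq {G : ℝ → ℝ → ℂ} (hG : CurveSmooth G)
    (hs : ∀ s t, 1 / 4 ≤ |s - 1 / 2| → G s t = 0) (ht : ∀ s t, 1 / 4 ≤ |t - 1 / 2| → G s t = 0)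
    {a : ℤ → ℂ} (ha : PolyGrowth a) :
    ∃ F : ℝ → ℂ, ContDiff ℝ ∞ F ∧
      ∀ t ∈ Ico (0 : ℝ) 1, ∑' n, a n * periodCoeff (fun s => G s t) n = F t := by
  have hc := hG.exists_double_periodCoeff_le hs ht
  -- `F` is the Fourier series in `t` obtained by summing over `n` first; its coefficients are
  -- constants that decay rapidly.
  refine ⟨_, (RapidSmooth.const (ha.exists_tsum_bound hc)).contDiff_tsum_mul_periodExp,
    fun t ht' => ?_⟩
  rw [← ha.tsum_comm_periodExp hc]
  refine tsum_congr fun n => ?_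
  obtain ⟨B, hB⟩ := hc 0 2
  rw [(hasSum_periodCoeff (hG.continuous_periodCoeff n) ?_
    (summable_of_intWeight_le fun m => by simpa using hB n m) ht').tsum_eq]
  simp only [ht _ 0 eventually_far_zero.self_of_nhds, ht _ 1 eventually_far_one.self_of_nhds]

theorem ContDiff.complex_of_re_im {f : ℝ → ℂ} (hre : ContDiff ℝ ∞ fun t => (f t).re)
    (him : ContDiff ℝ ∞ fun t => (f t).im) : ContDiff ℝ ∞ f := by
  have h := (Complex.ofRealCLM.contDiff.comp hre).add
    ((Complex.ofRealCLM.contDiff.comp him).mul (contDiff_const (c := Complex.I)))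
  exact h.of_eq fun t => Complex.re_add_im (f t)

/-! ### Smoothness along the graph of a generated curve. -/

section

variable {Y : Type u} {C₀ : Set (ℝ → Y)} {g : ℝ → Y → ℂ} {d : ℝ → Y}

/-- Smoothness is local in `t`: translating `t₀` to `1 / 2` and cutting off in `t` reduces to
functions supported inside the unit square, and the cut-off is 1 near `t₀`. -/
theorem contDiff_tsum_periodCoeff_comp {c : ℝ → Y} (hg : CurveSmooth fun s t => g s (c t))
    {a : ℤ → ℂ} (ha : PolyGrowth a) :
    ContDiff ℝ ∞ fun t => ∑' n, a n * periodCoeff (fun s => midBump s * g s (c t)) n := by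
  rw [contDiff_iff_contDiffAt]
  intro t₀
  obtain ⟨F, hF, hF'⟩ := CurveSmooth.exists_tsum_periodCoeff_eq
    (G := fun s t => midBump s * (midBump t * g s (c (t + (t₀ - 1 / 2)))))
    (fun σ τ hσ hτ => (contDiff_midBump.comp hσ).mul ((contDiff_midBump.comp hτ).mul
      (hg σ (fun u => τ u + (t₀ - 1 / 2)) hσ (hτ.add contDiff_const))))
    (fun s t h => by simp [midBump_eq_zero h]) (fun s t h => by simp [midBump_eq_zero h]) ha
  have hsh : ContDiff ℝ ∞ fun t => F (t - (t₀ - 1 / 2)) :=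
    hF.comp (contDiff_id.sub contDiff_const)
  refine hsh.contDiffAt.congr_of_eventuallyEq ?_
  have hlim : Tendsto (fun t => t - (t₀ - 1 / 2)) (𝓝 t₀) (𝓝 (1 / 2 : ℝ)) := by
    have : Continuous fun t : ℝ => t - (t₀ - 1 / 2) := by fun_prop
    simpa using this.tendsto t₀
  filter_upwards [hlim midBump_eventually_one,
    hlim (Ico_mem_nhds (show (0 : ℝ) < 1 / 2 by norm_num)
      (show (1 / 2 : ℝ) < 1 by norm_num))] with t h1 h2
  rw [← hF' _ h2]
  refine tsum_congr fun n => ?_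
  have h1' : midBump (t - (t₀ - 1 / 2)) = 1 := h1
  simp only [h1', sub_add_cancel, Complex.ofReal_one, one_mul]

/-- The passage from `C₀` to `d`: the real and imaginary parts of `y ↦ ∑ a n * (n-th coefficient at
y)` are smooth along `C₀`, and `hd` applies to such functions. The pointwise decay needs only that
some curve of `C₀` passes through `d t`. -/
theorem rapidSmooth_periodCoeff_comp (hcov : ∀ y, ∃ c ∈ C₀, ∃ t, c t = y)
    (hg : ∀ c ∈ C₀, CurveSmooth fun s t => g s (c t))
    (hd : ∀ f : Y → ℝ, (∀ c ∈ C₀, ContDiff ℝ ∞ (f ∘ c)) → ContDiff ℝ ∞ (f ∘ d)) :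
    RapidSmooth fun n t => periodCoeff (fun s => midBump s * g s (d t)) n where
  bounded p t := by
    obtain ⟨c, hc, r, hr⟩ := hcov (d t)
    obtain ⟨B, hB⟩ := CurveSmooth.exists_periodCoeff_le
      (G := fun s t => midBump s * g s (c r)) (fun σ τ hσ hτ => (contDiff_midBump.comp hσ).mul
        (hg c hc σ (fun _ => r) hσ contDiff_const)) (fun s t h => by simp [midBump_eq_zero h]) p
    refine ⟨B, fun n => ?_⟩
    rw [← hr]
    exact hB 0 (by simp) n
  smooth a ha := by
    let f : Y → ℂ := fun y => ∑' n, a n * periodCoeff (fun s => midBump s * g s y) n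
    have hf : ∀ c ∈ C₀, ContDiff ℝ ∞ fun t => f (c t) := fun c hc =>
      contDiff_tsum_periodCoeff_comp (hg c hc) ha
    exact ContDiff.complex_of_re_im (f := fun t => f (d t))
      (hd (fun y => (f y).re) fun c hc => Complex.reCLM.contDiff.comp (hf c hc))
      (hd (fun y => (f y).im) fun c hc => Complex.imCLM.contDiff.comp (hf c hc))

/-- Near `1 / 2` the cut-off is 1, and Fourier inversion in `s`, evaluated at `s = t`, writes `g t
(d t)` as the series of a `RapidSmooth` family. -/
theorem contDiffAt_diag_mid (hcov : ∀ y, ∃ c ∈ C₀, ∃ t, c t = y)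
    (hg : ∀ c ∈ C₀, CurveSmooth fun s t => g s (c t))
    (hd : ∀ f : Y → ℝ, (∀ c ∈ C₀, ContDiff ℝ ∞ (f ∘ c)) → ContDiff ℝ ∞ (f ∘ d)) :
    ContDiffAt ℝ ∞ (fun t => g t (d t)) (1 / 2) := by
  have hR := rapidSmooth_periodCoeff_comp hcov hg hd
  refine hR.contDiff_tsum_mul_periodExp.contDiffAt.congr_of_eventuallyEq ?_
  filter_upwards [midBump_eventually_one,
    Ico_mem_nhds (show (0 : ℝ) < 1 / 2 by norm_num) (show (1 / 2 : ℝ) < 1 by norm_num)] with t h1 h2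
  obtain ⟨c, hc, r, hr⟩ := hcov (d t)
  have hcd : ContDiff ℝ ∞ fun s => midBump s * g s (d t) := by
    rw [← hr]
    exact contDiff_midBump.mul (hg c hc _ (fun _ => r) contDiff_id contDiff_const)
  obtain ⟨B, hB⟩ := hR.bounded 2 t
  rw [(hasSum_periodCoeff hcd.continuous (by
    simp [midBump_eq_zero eventually_far_zero.self_of_nhds,
      midBump_eq_zero eventually_far_one.self_of_nhds]) (summable_of_intWeight_le hB) h2).tsum_eq,
    h1, Complex.ofReal_one, one_mul]

/-- Let `C₀` be a set of curves that covers `Y`, and let `d` be a curve that is smooth for the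
Frölicher structure generated by `C₀`. If a function on `ℝ × Y` is smooth along the product of
`ℝ` with each curve of `C₀`, then it is smooth along the graph of `d`. -/
theorem contDiff_diag (hcov : ∀ y, ∃ c ∈ C₀, ∃ t, c t = y)
    (hg : ∀ c ∈ C₀, CurveSmooth fun s t => g s (c t))
    (hd : ∀ f : Y → ℝ, (∀ c ∈ C₀, ContDiff ℝ ∞ (f ∘ c)) → ContDiff ℝ ∞ (f ∘ d)) :
    ContDiff ℝ ∞ fun t => g t (d t) := by
  rw [contDiff_iff_contDiffAt]
  intro t₀
  have hshift : ContDiff ℝ ∞ fun t : ℝ => t + (t₀ - 1 / 2) := contDiff_id.add contDiff_const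
  have hmid := contDiffAt_diag_mid (g := fun s => g (s + (t₀ - 1 / 2)))
    (d := fun t => d (t + (t₀ - 1 / 2))) hcov
    (fun c hc σ τ hσ hτ => hg c hc _ τ (hσ.add contDiff_const) hτ)
    (fun f hf => (hd f hf).comp hshift)
  have hback : ContDiffAt ℝ ∞ (fun t : ℝ => t - (t₀ - 1 / 2)) t₀ :=
    (contDiff_id.sub contDiff_const).contDiffAt
  have h := ContDiffAt.comp t₀ (by simpa using hmid) hback
  simpa [Function.comp_def] using h

end

end Analysis

/-! ### Products with a fixed space preserve quotients and coproducts. -/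

namespace FrolicherSpace

theorem const_mem_curves {X : Type u} [FrolicherSpace X] (x : X) :
    (fun _ => x) ∈ curves (X := X) :=
  (mem_curves_iff _).2 fun _ _ => contDiff_const

end FrolicherSpace

namespace FrlSmooth

variable {X : Type u} {Y : Type v} {Z : Type w} {W : Type x}
variable [FrolicherSpace X] [FrolicherSpace Y] [FrolicherSpace Z] [FrolicherSpace W]

theorem of_contDiff {φ : ℝ → ℝ} (hφ : ContDiff ℝ ∞ φ) : FrlSmooth φ :=
  fun f hf => ContDiff.comp (𝕜 := ℝ) (n := ∞) (g := f) hf hφ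

theorem mem_functions_of_real {f : X → ℝ} (hf : FrlSmooth f) : f ∈ functions (X := X) :=
  hf _root_.id (contDiff_id (𝕜 := ℝ) (E := ℝ) (n := ∞))

theorem real_of_mem_functions {f : X → ℝ} (hf : f ∈ functions (X := X)) : FrlSmooth f :=
  iff_curves.2 fun c hc => (mem_functions_iff f).1 hf c hc

theorem of_mem_curves {c : ℝ → X} (hc : c ∈ curves (X := X)) : FrlSmooth c :=
  fun f hf => (mem_curves_iff c).1 hc f hf

theorem unitInterval_val : FrlSmooth (fun t : unitInterval => (t : ℝ)) :=
  iff_curves.2 fun _ hc => mem_curves_unitInterval.1 hc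

theorem unitInterval_mk {φ : X → ℝ} (hφ : FrlSmooth φ) (h : ∀ x, φ x ∈ unitInterval) :
    FrlSmooth (fun x => (⟨φ x, h x⟩ : unitInterval)) :=
  iff_curves.2 fun c hc => mem_curves_unitInterval.2 (iff_curves.1 hφ c hc)

/-- A map on `Z × Y` is smooth as soon as it is smooth along the products of `Z` with the curves of
a generating and covering set of curves of `Y`. -/
theorem of_generating {C₀ : Set (ℝ → Y)} (hcov : ∀ y, ∃ c ∈ C₀, ∃ t, c t = y)
    (hgen : ∀ f : Y → ℝ, (∀ c ∈ C₀, ContDiff ℝ ∞ (f ∘ c)) → f ∈ functions (X := Y))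
    {g : Z × Y → W} (hg : ∀ c ∈ C₀, FrlSmooth fun p : Z × ℝ => g (p.1, c p.2)) : FrlSmooth g := by
  intro e he
  rw [mem_functions_iff]
  intro γ hγ
  obtain ⟨hz, hd⟩ := mem_curves_prod.1 hγ
  -- Inserting the `Z`-component of `γ` into the first variable makes the composite with `γ` a
  -- diagonal `t ↦ g t (d t)`.
  have key := contDiff_diag (C₀ := C₀) (g := fun s y => ((e (g ((γ s).1, y)) : ℝ) : ℂ))
    (d := fun s => (γ s).2) hcov
    (fun c hc σ τ hσ hτ => Complex.ofRealCLM.contDiff.comp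
      ((mem_functions_iff _).1 (hg c hc e he) (fun u => ((γ (σ u)).1, τ u))
        (mem_curves_prod.2 ⟨(mem_curves_iff _).2 fun f hf =>
          ((mem_curves_iff _).1 hz f hf).comp hσ, hτ⟩)))
    (fun f hf => (mem_curves_iff _).1 hd f (hgen f hf))
  exact Complex.reCLM.contDiff.comp key

/-- The product with `Z` preserves quotients. -/
theorem of_prod_quot {r : X → X → Prop} {g : Z × Quot r → W}
    (hg : FrlSmooth fun p : Z × X => g (p.1, Quot.mk r p.2)) : FrlSmooth g := by
  refine of_generating (C₀ := {d | ∃ c ∈ curves (X := X), d = Quot.mk r ∘ c}) ?_ ?_ ?_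
  · rintro ⟨x⟩
    exact ⟨_, ⟨_, const_mem_curves x, rfl⟩, 0, rfl⟩
  · exact fun f hf => hf
  · rintro _ ⟨c, hc, rfl⟩
    exact hg.comp (fst.prodMk ((of_mem_curves hc).comp snd))

/-- The product with `Z` preserves coproducts. -/
theorem of_prod_sum {g : Z × (X ⊕ Y) → W} (h₁ : FrlSmooth fun p : Z × X => g (p.1, Sum.inl p.2))
    (h₂ : FrlSmooth fun p : Z × Y => g (p.1, Sum.inr p.2)) : FrlSmooth g := by
  refine of_generating (C₀ := {d | ∃ c ∈ curves (X := X), d = Sum.inl ∘ c} ∪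
    {d | ∃ c ∈ curves (X := Y), d = Sum.inr ∘ c}) ?_ ?_ ?_
  · rintro (x | y)
    · exact ⟨_, Or.inl ⟨_, const_mem_curves x, rfl⟩, 0, rfl⟩
    · exact ⟨_, Or.inr ⟨_, const_mem_curves y, rfl⟩, 0, rfl⟩
  · exact fun f hf => hf
  · rintro _ (⟨c, hc, rfl⟩ | ⟨c, hc, rfl⟩)
    · exact h₁.comp (fst.prodMk ((of_mem_curves hc).comp snd))
    · exact h₂.comp (fst.prodMk ((of_mem_curves hc).comp snd))

/-- Gluing of smooth maps that agree where a smooth function takes values in an open interval. -/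
theorem glue {ρ : Z → ℝ} (hρ : FrlSmooth ρ) {K φ ψ : Z → W} (hφ : FrlSmooth φ) (hψ : FrlSmooth ψ)
    {a b : ℝ} (hab : a < b) (h₁ : ∀ z, ρ z < b → K z = φ z) (h₂ : ∀ z, a < ρ z → K z = ψ z) :
    FrlSmooth K := by
  intro e he
  rw [mem_functions_iff]
  intro c hc
  have ht : ContDiff ℝ ∞ fun s => ρ (c s) := iff_curves.1 hρ c hc
  have c1 := (mem_functions_iff _).1 (hφ e he) c hc
  have c2 := (mem_functions_iff _).1 (hψ e he) c hc
  rw [contDiff_iff_contDiffAt]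
  intro s
  by_cases hs : ρ (c s) < b
  · refine c1.contDiffAt.congr_of_eventuallyEq ?_
    filter_upwards [ht.continuous.continuousAt.eventually_lt continuousAt_const hs] with r hr
    simp only [Function.comp_apply]
    rw [h₁ _ hr]
  · refine c2.contDiffAt.congr_of_eventuallyEq ?_
    have hs' : a < ρ (c s) := by linarith [not_lt.1 hs]
    filter_upwards [continuousAt_const.eventually_lt ht.continuous.continuousAt hs'] with r hr
    simp only [Function.comp_apply]
    rw [h₂ _ hr]

end FrlSmooth

/-! ### Convex combinations and smooth steps in the unit interval. -/

/-- The convex combination `(1 - s) a + s b` in the unit interval. -/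
noncomputable def unitInterval.mix (s a b : unitInterval) : unitInterval :=
  ⟨(1 - s) * a + s * b, by
    have hs := s.2.1
    have hs' := s.2.2
    have ha := a.2.1
    have ha' := a.2.2
    have hb := b.2.1
    have hb' := b.2.2
    constructor
    · have := mul_nonneg (sub_nonneg.2 hs') ha
      have := mul_nonneg hs hb
      linarith
    · nlinarith⟩

namespace FrlSmooth

variable {X : Type u} [FrolicherSpace X]

theorem mix {s a b : X → unitInterval} (hs : FrlSmooth s) (ha : FrlSmooth a) (hb : FrlSmooth b) :
    FrlSmooth fun x => unitInterval.mix (s x) (a x) (b x) :=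
  iff_curves.2 fun c hc => mem_curves_unitInterval.2 <|
    ((contDiff_const.sub (mem_curves_unitInterval.1 (iff_curves.1 hs c hc))).mul
      (mem_curves_unitInterval.1 (iff_curves.1 ha c hc))).add
      ((mem_curves_unitInterval.1 (iff_curves.1 hs c hc)).mul
        (mem_curves_unitInterval.1 (iff_curves.1 hb c hc)))

end FrlSmooth

namespace unitInterval

@[simp] theorem mix_zero (a b : unitInterval) : mix 0 a b = a := Subtype.ext (by simp [mix])

@[simp] theorem mix_one (a b : unitInterval) : mix 1 a b = b := Subtype.ext (by simp [mix])

@[simp] theorem mix_self (s a : unitInterval) : mix s a a = a := Subtype.ext (by simp [mix]; ring)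

/-- The smooth step that increases from `0` at `a` to `1` at `b`. -/
noncomputable def step (a b : ℝ) (t : ℝ) : unitInterval :=
  ⟨Real.smoothTransition ((t - a) / (b - a)), Real.smoothTransition.nonneg _,
    Real.smoothTransition.le_one _⟩

theorem step_eq_zero {a b t : ℝ} (hab : a < b) (ht : t ≤ a) : step a b t = 0 :=
  Subtype.ext (Real.smoothTransition.zero_of_nonpos
    (div_nonpos_of_nonpos_of_nonneg (by linarith) (by linarith)))

theorem step_eq_one {a b t : ℝ} (hab : a < b) (ht : b ≤ t) : step a b t = 1 :=
  Subtype.ext (Real.smoothTransition.one_of_one_le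
    ((one_le_div (by linarith)).2 (by linarith)))

theorem contDiff_step (a b : ℝ) : ContDiff ℝ ∞ fun t => (step a b t : ℝ) :=
  Real.smoothTransition.contDiff.comp (by fun_prop)

theorem smooth_step (a b : ℝ) : FrlSmooth (step a b) :=
  FrlSmooth.unitInterval_mk (FrlSmooth.of_contDiff (contDiff_step a b)) _

end unitInterval

/-! ### Reparametrizations of the flattened interval. -/

namespace FlatInterval

open unitInterval

/-- The identity from the usual to the flattened unit interval. -/
def ofUnit (t : unitInterval) : FlatInterval := t

/-- The underlying point of the usual unit interval. -/
def toUnit (t : FlatInterval) : unitInterval := t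

@[simp] theorem ofUnit_toUnit (t : FlatInterval) : ofUnit (toUnit t) = t := rfl
@[simp] theorem toUnit_zero : toUnit zero = 0 := rfl
@[simp] theorem toUnit_one : toUnit one = 1 := rfl
@[simp] theorem ofUnit_zero : ofUnit 0 = zero := rfl
@[simp] theorem ofUnit_one : ofUnit 1 = one := rfl

/-- Smoothness into the flattened interval is tested by the generating functions. -/
theorem smooth_of_generators {X : Type u} [FrolicherSpace X] {φ : X → FlatInterval}
    (h : ∀ f : unitInterval → ℝ, f ∈ functions (X := unitInterval) → ∀ ε : ℝ, 0 < ε → ε < 1 / 4 →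
      (∀ t : unitInterval, (t : ℝ) < ε → f t = f 0) →
      (∀ t : unitInterval, 1 - ε < (t : ℝ) → f t = f 1) →
      FrlSmooth fun x => f (toUnit (φ x))) : FrlSmooth φ := by
  rw [FrlSmooth.iff_curves]
  rintro c hc f ⟨hf, ε, h0, h4, h1, h2⟩
  exact FrlSmooth.iff_curves.1 (h f hf ε h0 h4 h1 h2) c hc

theorem smooth_ofUnit : FrlSmooth ofUnit :=
  smooth_of_generators fun _ hf _ _ _ _ _ => FrlSmooth.real_of_mem_functions hf

/-- A smooth function on the line whose restriction to the unit interval is constant near the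
endpoints is smooth on the flattened interval. -/
theorem smooth_of_contDiff {φ : ℝ → unitInterval} (hφ : ContDiff ℝ ∞ fun t => (φ t : ℝ)) {ε : ℝ}
    (hε : 0 < ε) (h0 : ∀ t < ε, φ t = φ 0) (h1 : ∀ t, 1 - ε < t → φ t = φ 1) :
    FrlSmooth fun t : FlatInterval => φ (toUnit t) := by
  refine FrlSmooth.unitInterval_mk (φ := fun t : FlatInterval => (φ (toUnit t) : ℝ)) ?_
    fun t => (φ (toUnit t)).2
  refine FrlSmooth.real_of_mem_functions fun c hc => hc (fun t : unitInterval => (φ t : ℝ)) ?_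
  -- The minimum with `1 / 5` meets the requirement that the flat ends be shorter than `1 / 4`.
  refine ⟨?_, min ε (1 / 5), by positivity, (min_le_right _ _).trans_lt (by norm_num), ?_, ?_⟩
  · exact FrlSmooth.mem_functions_of_real
      ((FrlSmooth.of_contDiff hφ).comp FrlSmooth.unitInterval_val)
  · intro t ht
    simp [h0 t (ht.trans_le (min_le_left _ _))]
  · intro t ht
    have := min_le_left ε (1 / 5)
    simp [h1 t (by linarith)]

/-- The braking reparametrization, which is `0` on `[0, 1/4]` and `1` on `[3/4, 1]`. -/
noncomputable def brake (t : FlatInterval) : unitInterval := step (1 / 4) (3 / 4) (toUnit t)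

theorem smooth_brake : FrlSmooth brake :=
  smooth_of_contDiff (φ := step (1 / 4) (3 / 4)) (contDiff_step _ _) (ε := 1 / 4) (by norm_num)
    (fun t ht => by
      rw [step_eq_zero (by norm_num) ht.le, step_eq_zero (by norm_num) (by norm_num)])
    (fun t ht => by
      rw [step_eq_one (by norm_num) (by linarith), step_eq_one (by norm_num) (by norm_num)])

theorem brake_eq_zero {t : FlatInterval} (ht : (toUnit t : ℝ) ≤ 1 / 4) : brake t = 0 :=
  step_eq_zero (by norm_num) ht

theorem brake_eq_one {t : FlatInterval} (ht : 3 / 4 ≤ (toUnit t : ℝ)) : brake t = 1 :=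
  step_eq_one (by norm_num) ht

@[simp] theorem brake_zero : brake zero = 0 := brake_eq_zero (by simp)
@[simp] theorem brake_one : brake one = 1 := brake_eq_one (by norm_num)

/-- A flattening of the identity that changes it only close to the endpoints. -/
theorem exists_flattening {ε : ℝ} (hε : 0 < ε) (hε' : ε < 1 / 4) :
    ∃ β : FlatInterval → unitInterval, FrlSmooth β ∧
      (∀ t, (toUnit t : ℝ) < ε → (β t : ℝ) < ε) ∧
      (∀ t, 1 - ε < (toUnit t : ℝ) → 1 - ε < (β t : ℝ)) ∧
      ∀ t, ε ≤ (toUnit t : ℝ) → (toUnit t : ℝ) ≤ 1 - ε → β t = toUnit t := by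
  have hlt : ε / 2 < ε := by linarith
  -- On the left half this is `t` times a step that vanishes up to `ε / 2`; on the right half it is
  -- the mirror image under `t ↦ 1 - t`. Since `ε < 1 / 4`, on each half the other factor is 1.
  set φ : ℝ → ℝ := fun t => 1 - step (ε / 2) ε (1 - t) * (1 - step (ε / 2) ε t * t) with hφ
  have hlow : ∀ t ≤ 1 / 2, φ t = step (ε / 2) ε t * t := by
    intro t ht
    simp only [hφ]
    rw [step_eq_one hlt (t := 1 - t) (by linarith)]
    simp
  have hhigh : ∀ t, 1 / 2 ≤ t → φ t = 1 - step (ε / 2) ε (1 - t) * (1 - t) := by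
    intro t ht
    simp only [hφ]
    rw [step_eq_one hlt (t := t) (by linarith)]
    simp
  have hb : ∀ t u : ℝ, 0 ≤ u → 0 ≤ (step (ε / 2) ε t : ℝ) * u ∧
      (step (ε / 2) ε t : ℝ) * u ≤ u := fun t u hu =>
    ⟨mul_nonneg (step _ _ _).2.1 hu, mul_le_of_le_one_left hu (step _ _ _).2.2⟩
  have hclamp : ContDiff ℝ ∞ φ := contDiff_const.sub
    (((contDiff_step _ _).comp (contDiff_const.sub contDiff_id)).mul
      (contDiff_const.sub ((contDiff_step _ _).mul contDiff_id)))
  have hmem : ∀ t : FlatInterval, φ (toUnit t) ∈ unitInterval := by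
    intro t
    have h0 := (toUnit t).2.1
    have h1 := (toUnit t).2.2
    rcases le_total (toUnit t : ℝ) (1 / 2) with h | h
    · rw [hlow _ h]
      exact ⟨(hb _ _ h0).1, (hb _ _ h0).2.trans h1⟩
    · rw [hhigh _ h]
      have := hb (1 - toUnit t) (1 - toUnit t) (by linarith)
      exact ⟨by linarith, by linarith⟩
  refine ⟨fun t => ⟨φ (toUnit t), hmem t⟩, FrlSmooth.unitInterval_mk ?_ hmem, ?_, ?_, ?_⟩
  · refine FrlSmooth.real_of_mem_functions fun c hc => hc (fun t : unitInterval => φ t) ?_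
    refine ⟨FrlSmooth.mem_functions_of_real
      ((FrlSmooth.of_contDiff hclamp).comp FrlSmooth.unitInterval_val), ε / 2, by linarith,
      by linarith, fun t ht => ?_, fun t ht => ?_⟩
    · change φ t = φ ((0 : unitInterval) : ℝ)
      rw [hlow _ (by linarith), hlow _ (by norm_num), step_eq_zero hlt ht.le]
      simp
    · change φ t = φ ((1 : unitInterval) : ℝ)
      rw [hhigh _ (by linarith), hhigh _ (by norm_num), step_eq_zero hlt (by linarith)]
      simp
  · intro t ht
    simp only
    rw [hlow _ (by linarith)]
    exact (hb _ _ (toUnit t).2.1).2.trans_lt ht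
  · intro t ht
    simp only
    rw [hhigh _ (by linarith)]
    have := (hb (1 - toUnit t) (1 - toUnit t) (by linarith [(toUnit t).2.2])).2
    linarith
  · intro t h1 h2
    refine Subtype.ext ?_
    simp only
    rcases le_total (toUnit t : ℝ) (1 / 2) with h | h
    · rw [hlow _ h, step_eq_one hlt h1]
      simp
    · rw [hhigh _ h, step_eq_one hlt (by linarith)]
      simp

/-- A flat reparametrization of the flattened interval can be deformed linearly to the identity. -/
theorem smooth_mix {φ : FlatInterval → unitInterval} (hφ : FrlSmooth φ)
    (h0 : ∀ t, (toUnit t : ℝ) ≤ 1 / 4 → φ t = 0) (h1 : ∀ t, 3 / 4 ≤ (toUnit t : ℝ) → φ t = 1) :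
    FrlSmooth fun p : unitInterval × FlatInterval => ofUnit (mix p.1 (toUnit p.2) (φ p.2)) := by
  refine smooth_of_generators fun f hf ε hε hε' hf0 hf1 => ?_
  obtain ⟨β, hβ, hβ0, hβ1, hβ'⟩ := exists_flattening hε hε'
  -- The map `toUnit` is not smooth on the flattened interval. Replacing it by the smooth `β`
  -- changes it only near the endpoints, where both combinations stay within the zone on which `f`
  -- is constant.
  have key : (fun p : unitInterval × FlatInterval => f (mix p.1 (toUnit p.2) (φ p.2))) =
      fun p => f (mix p.1 (β p.2) (φ p.2)) := by
    ext ⟨s, t⟩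
    have hs := s.2.1
    have hs' := s.2.2
    rcases lt_or_ge (toUnit t : ℝ) ε with ht | ht
    · have e : ∀ a : unitInterval, (a : ℝ) < ε → f (mix s a (φ t)) = f 0 := by
        intro a ha
        refine hf0 _ ?_
        rw [h0 t (by linarith)]
        simp only [mix, Set.Icc.coe_zero, mul_zero, add_zero]
        nlinarith [a.2.1]
      simp only [e _ ht, e _ (hβ0 t ht)]
    rcases lt_or_ge (1 - ε) (toUnit t : ℝ) with ht' | ht'
    · have e : ∀ a : unitInterval, 1 - ε < (a : ℝ) → f (mix s a (φ t)) = f 1 := by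
        intro a ha
        refine hf1 _ ?_
        rw [h1 t (by linarith)]
        simp only [mix, Set.Icc.coe_one, mul_one]
        nlinarith [a.2.2]
      simp only [e _ ht', e _ (hβ1 t ht')]
    · simp only [hβ' t ht ht']
  change FrlSmooth fun p : unitInterval × FlatInterval => f (mix p.1 (toUnit p.2) (φ p.2))
  rw [key]
  exact (FrlSmooth.real_of_mem_functions hf).comp
    (FrlSmooth.mix FrlSmooth.fst (hβ.comp FrlSmooth.snd) (hφ.comp FrlSmooth.snd))

end FlatInterval

/-! ### Mapping spaces and the adjunction between suspension and loops. -/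

namespace PointedFrl

/-- The pointed mapping space. A curve of pointed maps belongs to the generating set if its adjoint
is smooth. -/
def mapSpace (S : PointedFrl.{u}) (W : PointedFrl.{v}) : PointedFrl.{max u v} where
  carrier := Hom S W
  str := ofCurves {c | FrlSmooth fun p : ℝ × S => c p.1 p.2}
  pt := Hom.trivial S W

/-- The non-formal half of cartesian closedness: curves of the mapping space need not visibly have
smooth adjoints, but the generating ones do, and the constant ones among them cover. -/
theorem mapSpace_eval {S : PointedFrl.{u}} {W : PointedFrl.{v}} :
    FrlSmooth fun p : S × mapSpace S W => Hom.toFun p.2 p.1 := by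
  refine FrlSmooth.of_generating
    (C₀ := {c : ℝ → mapSpace S W | FrlSmooth fun p : ℝ × S => Hom.toFun (c p.1) p.2}) ?_ ?_ ?_
  · intro f
    exact ⟨fun _ => f, (Hom.smooth f).comp FrlSmooth.snd, 0, rfl⟩
  · exact fun f hf => hf
  · intro c hc
    exact FrlSmooth.comp (φ := fun p : S × ℝ => (p.2, p.1)) hc
      (FrlSmooth.snd.prodMk FrlSmooth.fst)

/-- The formal half: `φ` carries every curve of `Y` into the generating set. -/
theorem mapSpace_curry {S : PointedFrl.{u}} {W : PointedFrl.{v}} {Y : Type w} [FrolicherSpace Y]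
    {φ : Y → mapSpace S W} (hφ : FrlSmooth fun p : Y × S => Hom.toFun (φ p.1) p.2) :
    FrlSmooth φ := by
  rw [FrlSmooth.iff_curves]
  intro c hc f hf
  refine hf _ ?_
  exact hφ.comp (((FrlSmooth.of_mem_curves hc).comp FrlSmooth.fst).prodMk FrlSmooth.snd)

/-- The space of pointed maps from the flattened circle. -/
def loop (W : PointedFrl.{u}) : PointedFrl.{u} := mapSpace flatCircle W

/-- The point `s ∧ y` of the suspension. -/
def smashMk {Y : PointedFrl.{u}} (s : flatCircle) (y : Y) : susp Y := Quot.mk _ (s, y)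

theorem smashMk_smooth {Y : PointedFrl.{u}} :
    FrlSmooth fun p : flatCircle × Y => smashMk p.1 p.2 :=
  FrlSmooth.quotMk _

theorem smashMk_eq_pt {Y : PointedFrl.{u}} {s : flatCircle} {y : Y}
    (h : s = flatCircle.pt ∨ y = Y.pt) : smashMk s y = (susp Y).pt :=
  Quot.sound ⟨h, Or.inl rfl⟩

/-- A smooth family of pointed maps on a suspension, from a map on a product. -/
theorem exists_smash_lift {Z : Type v} [FrolicherSpace Z] {Y : PointedFrl.{u}}
    {W : PointedFrl.{w}} (φ : Z × (flatCircle × Y) → W) (hφ : FrlSmooth φ)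
    (h : ∀ z s y, s = flatCircle.pt ∨ y = Y.pt → φ (z, (s, y)) = W.pt) :
    ∃ F : Z × susp Y → W, FrlSmooth F ∧ ∀ z s y, F (z, smashMk s y) = φ (z, (s, y)) := by
  refine ⟨fun p => Quot.lift (fun q => φ (p.1, q)) ?_ p.2, ?_, fun _ _ _ => rfl⟩
  · rintro ⟨s, y⟩ ⟨s', y'⟩ ⟨h₁, h₂⟩
    exact (h _ _ _ h₁).trans (h _ _ _ h₂).symm
  · exact FrlSmooth.of_prod_quot hφ

/-- The adjoint `Y → Ω W` of a pointed map `Σ Y → W`. -/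
def Hom.toLoop {Y : PointedFrl.{u}} {W : PointedFrl.{u}} (h : Hom (PointedFrl.susp Y) W) :
    Hom Y (loop W) where
  toFun y :=
    { toFun := fun s => h (smashMk s y)
      smooth := h.smooth.comp (smashMk_smooth.comp (FrlSmooth.id.prodMk (FrlSmooth.const y)))
      map_pt := (congrArg h (smashMk_eq_pt (Or.inl rfl))).trans h.map_pt }
  smooth := mapSpace_curry (h.smooth.comp (smashMk_smooth.comp
    (FrlSmooth.snd.prodMk FrlSmooth.fst)))
  map_pt := Hom.ext (funext fun _ =>
    (congrArg h (smashMk_eq_pt (Or.inr rfl))).trans h.map_pt)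

theorem Homotopic.toLoop {Y : PointedFrl.{u}} {W : PointedFrl.{u}}
    {h h' : Hom (PointedFrl.susp Y) W} (H : Homotopic h h') : Homotopic h.toLoop h'.toLoop := by
  obtain ⟨F, hF, hp, h0, h1⟩ := H
  refine ⟨fun p =>
    { toFun := fun s => F (p.1, smashMk s p.2)
      smooth := hF.comp ((FrlSmooth.const p.1).prodMk
        (smashMk_smooth.comp (FrlSmooth.id.prodMk (FrlSmooth.const p.2))))
      map_pt := by rw [smashMk_eq_pt (Or.inl rfl), hp] }, ?_, ?_, ?_, ?_⟩
  · exact mapSpace_curry (hF.comp ((FrlSmooth.fst.comp FrlSmooth.fst).prodMk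
      (smashMk_smooth.comp (FrlSmooth.snd.prodMk (FrlSmooth.snd.comp FrlSmooth.fst)))))
  · intro t
    refine Hom.ext (funext fun s => ?_)
    change F (t, smashMk s Y.pt) = W.pt
    rw [smashMk_eq_pt (Or.inr rfl), hp]
  · intro y
    exact Hom.ext (funext fun s => h0 _)
  · intro y
    exact Hom.ext (funext fun s => h1 _)

/-- The adjoint `Σ Y → W` of a pointed map `Y → Ω W`. -/
def Hom.ofLoop {Y : PointedFrl.{u}} {W : PointedFrl.{u}} (φ : Hom Y (loop W)) :
    Hom (PointedFrl.susp Y) W where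
  toFun := Quot.lift (fun p : flatCircle × Y => Hom.toFun (φ p.2) p.1) (by
    have key : ∀ p : flatCircle × Y, p.1 = flatCircle.pt ∨ p.2 = Y.pt →
        Hom.toFun (φ p.2) p.1 = W.pt := by
      rintro ⟨s, y⟩ (h | h)
      · simp only at h
        rw [h]
        exact Hom.map_pt (φ y)
      · simp only at h
        rw [h, φ.map_pt]
        rfl
    exact fun p q h => (key p h.1).trans (key q h.2).symm)
  smooth := FrlSmooth.quotLift
    (mapSpace_eval.comp (FrlSmooth.fst.prodMk (φ.smooth.comp FrlSmooth.snd))) _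
  map_pt := Hom.map_pt (φ Y.pt)

theorem Hom.ofLoop_toLoop {Y : PointedFrl.{u}} {W : PointedFrl.{u}}
    (h : Hom (PointedFrl.susp Y) W) : h.toLoop.ofLoop = h := by
  refine Hom.ext (funext ?_)
  rintro ⟨s, y⟩
  rfl

theorem Homotopic.ofLoop {Y : PointedFrl.{u}} {W : PointedFrl.{u}} {φ φ' : Hom Y (loop W)}
    (H : Homotopic φ φ') : Homotopic φ.ofLoop φ'.ofLoop := by
  obtain ⟨F, hF, hp, h0, h1⟩ := H
  obtain ⟨G, hG, hG'⟩ := exists_smash_lift (Z := unitInterval) (W := W)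
    (fun p : unitInterval × (flatCircle × Y) => Hom.toFun (F (p.1, p.2.2)) p.2.1)
    (mapSpace_eval.comp ((FrlSmooth.fst.comp FrlSmooth.snd).prodMk
      (hF.comp (FrlSmooth.fst.prodMk (FrlSmooth.snd.comp FrlSmooth.snd))))) (by
      rintro t s y (rfl | rfl)
      · exact Hom.map_pt (F (t, y))
      · simp only [hp]
        rfl)
  refine ⟨G, hG, ?_, ?_, ?_⟩
  · intro t
    rw [← smashMk_eq_pt (s := flatCircle.pt) (y := Y.pt) (Or.inl rfl), hG']
    exact Hom.map_pt (F (t, Y.pt))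
  · rintro ⟨s, y⟩
    refine (hG' 0 s y).trans ?_
    simp only [h0]
    rfl
  · rintro ⟨s, y⟩
    refine (hG' 1 s y).trans ?_
    simp only [h1]
    rfl

/-! ### Exactness in terms of maps, and its passage to suspensions. -/

/-- Exactness in terms of maps instead of homotopy classes. -/
theorem exactAt_pullback_iff {X Y Z : PointedFrl.{u}} {g : Hom X Y} {f : Hom Y Z}
    {W : PointedFrl.{u}} :
    Pointed.ExactAt (f.pullback W) (g.pullback W) ↔
      ∀ h : Hom Y W, (∃ h' : Hom Z W, Homotopic (h'.comp f) h) ↔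
        Homotopic (h.comp g) (Hom.trivial X W) := by
  have key : ∀ h : Hom Y W,
      (Quotient.mk (homotopySetoid Y W) h ∈ Set.range (f.pullback W).toFun ↔
        ∃ h' : Hom Z W, Homotopic (h'.comp f) h) ∧
      (Quotient.mk (homotopySetoid Y W) h ∈
          (g.pullback W).toFun ⁻¹' {(HomotopyClasses X W).point} ↔
        Homotopic (h.comp g) (Hom.trivial X W)) := by
    intro h
    refine ⟨⟨?_, ?_⟩, ?_⟩
    · rintro ⟨⟨h'⟩, e⟩
      exact ⟨h', Quotient.exact (s := homotopySetoid Y W) e⟩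
    · rintro ⟨h', e⟩
      exact ⟨Quotient.mk (homotopySetoid Z W) h', Quotient.sound (s := homotopySetoid Y W) e⟩
    · exact Quotient.eq (r := homotopySetoid X W)
  constructor
  · intro hE h
    rw [← (key h).1, ← (key h).2, hE]
  · intro hE
    ext ⟨h⟩
    exact (key h).1.trans ((hE h).trans (key h).2.symm)

/-- Suspension preserves sequences that are exact for all targets. -/
theorem exactAt_susp {X Y Z : PointedFrl.{u}} {g : Hom X Y} {f : Hom Y Z}
    (h : ∀ W : PointedFrl.{u}, Pointed.ExactAt (f.pullback W) (g.pullback W))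
    (W : PointedFrl.{u}) : Pointed.ExactAt (f.susp.pullback W) (g.susp.pullback W) := by
  rw [exactAt_pullback_iff]
  intro k
  -- Naturality of the adjunction is definitional: `k.toLoop.comp g` unfolds to `(k.comp
  -- g.susp).toLoop`.
  have hk := exactAt_pullback_iff.1 (h (loop W)) k.toLoop
  constructor
  · rintro ⟨k', hk'⟩
    have h1 := (hk.1 ⟨k'.toLoop, hk'.toLoop⟩).ofLoop
    have e1 : (k.toLoop.comp g).ofLoop = k.comp g.susp := Hom.ofLoop_toLoop (k.comp g.susp)
    have e2 : (Hom.trivial X (loop W)).ofLoop = Hom.trivial (susp X) W :=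
      Hom.ofLoop_toLoop (Hom.trivial (susp X) W)
    rwa [e1, e2] at h1
  · intro hnull
    obtain ⟨k', hk'⟩ := hk.2 hnull.toLoop
    refine ⟨k'.ofLoop, ?_⟩
    have h1 := hk'.ofLoop
    rw [Hom.ofLoop_toLoop] at h1
    have e1 : (k'.comp f).ofLoop = k'.ofLoop.comp f.susp := by
      refine Hom.ext (funext ?_)
      rintro ⟨s, y⟩
      rfl
    rwa [e1] at h1

/-- Each suspension costs one passage from `W` to `loop W`, so the induction carries exactness for
all targets. -/
theorem exactAt_iterSusp (n : ℕ) {X Y Z : PointedFrl.{u}} {g : Hom X Y} {f : Hom Y Z}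
    (h : ∀ W : PointedFrl.{u}, Pointed.ExactAt (f.pullback W) (g.pullback W))
    (W : PointedFrl.{u}) :
    Pointed.ExactAt ((f.iterSusp n).pullback W) ((g.iterSusp n).pullback W) := by
  induction n generalizing X Y Z with
  | zero => exact h W
  | succ n ih => exact ih (exactAt_susp h)

end PointedFrl

/-! ### Gluing maps and homotopies on suspensions and cones. -/

namespace PointedFrl

open unitInterval FlatInterval

theorem Homotopic.comp_right {X Y : PointedFrl.{u}} {W : PointedFrl.{v}} {h h' : Hom Y W}
    (H : Homotopic h h') (f : Hom X Y) : Homotopic (h.comp f) (h'.comp f) := by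
  obtain ⟨F, hF, hp, h0, h1⟩ := H
  refine ⟨fun p => F (p.1, f p.2),
    hF.comp (FrlSmooth.fst.prodMk (f.smooth.comp FrlSmooth.snd)), fun t => ?_,
    fun _ => h0 _, fun _ => h1 _⟩
  simp only [f.map_pt, hp]

theorem Homotopic.comp_left {X Y : PointedFrl.{u}} {W : PointedFrl.{v}} {h h' : Hom X Y}
    (H : Homotopic h h') (g : Hom Y W) : Homotopic (g.comp h) (g.comp h') := by
  obtain ⟨F, hF, hp, h0, h1⟩ := H
  refine ⟨fun p => g (F p), g.smooth.comp hF, fun t => ?_, fun y => ?_, fun y => ?_⟩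
  · simp only [hp, g.map_pt]
  · simp only [h0]; rfl
  · simp only [h1]; rfl

section Susp

variable {A : PointedFrl.{u}} {W : PointedFrl.{v}}

theorem susp_ind {p : susp A → Prop} (h : ∀ t a, p (suspMk t a)) (y : susp A) : p y := by
  rcases y with ⟨⟨t⟩, a⟩
  exact h t a

/-- A smooth family of maps on the suspension, from a map on a product with the flattened
interval. -/
theorem exists_susp_lift {Z : Type w} [FrolicherSpace Z] (φ : Z × (FlatInterval × A) → W)
    (hφ : FrlSmooth φ) (h0 : ∀ z a, φ (z, (zero, a)) = W.pt) (h1 : ∀ z a, φ (z, (one, a)) = W.pt)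
    (hp : ∀ z t, φ (z, (t, A.pt)) = W.pt) :
    ∃ F : Z × susp A → W, FrlSmooth F ∧ ∀ z t a, F (z, suspMk t a) = φ (z, (t, a)) := by
  have hend : ∀ z a t, t = zero ∨ t = one → φ (z, (t, a)) = W.pt := by
    rintro z a t (rfl | rfl)
    exacts [h0 z a, h1 z a]
  let ψ : (Z × A) × flatCircle → W := fun p =>
    Quot.lift (fun t : FlatInterval => φ (p.1.1, (t, p.1.2)))
      (fun s t h => (hend _ _ _ h.1).trans (hend _ _ _ h.2).symm) p.2
  have hψ : FrlSmooth ψ := FrlSmooth.of_prod_quot <|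
    hφ.comp (φ := fun p : (Z × A) × FlatInterval => (p.1.1, (p.2, p.1.2)))
      ((FrlSmooth.fst.comp FrlSmooth.fst).prodMk
        (FrlSmooth.snd.prodMk (FrlSmooth.snd.comp FrlSmooth.fst)))
  obtain ⟨F, hF, hF'⟩ := exists_smash_lift (fun p : Z × (flatCircle × A) =>
      ψ ((p.1, p.2.2), p.2.1))
    (hψ.comp ((FrlSmooth.fst.prodMk (FrlSmooth.snd.comp FrlSmooth.snd)).prodMk
      (FrlSmooth.fst.comp FrlSmooth.snd))) (by
      rintro z ⟨t⟩ a (h | rfl)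
      · rw [h]
        exact h0 z a
      · exact hp z t)
  exact ⟨F, hF, fun z t a => hF' z _ a⟩

theorem exists_susp_hom (φ : FlatInterval × A → W) (hφ : FrlSmooth φ)
    (h0 : ∀ a, φ (zero, a) = W.pt) (h1 : ∀ a, φ (one, a) = W.pt) (hp : ∀ t, φ (t, A.pt) = W.pt) :
    ∃ h : Hom (susp A) W, ∀ t a, h (suspMk t a) = φ (t, a) := by
  -- A constant family over a dummy parameter, evaluated at 0.
  obtain ⟨F, hF, hF'⟩ := exists_susp_lift (Z := unitInterval) (fun p => φ p.2) (hφ.comp FrlSmooth.snd)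
    (fun _ => h0) (fun _ => h1) (fun _ => hp)
  exact ⟨⟨fun y => F (0, y), hF.comp ((FrlSmooth.const 0).prodMk FrlSmooth.id),
    (hF' 0 zero A.pt).trans (h0 _)⟩, hF' 0⟩

/-- Deforming a map on the suspension along a map on a product with the flattened interval. -/
theorem exists_susp_homotopic (f : Hom (susp A) W) (φ : unitInterval × (FlatInterval × A) → W)
    (hφ : FrlSmooth φ) (h0 : ∀ s a, φ (s, (zero, a)) = W.pt)
    (h1 : ∀ s a, φ (s, (one, a)) = W.pt) (hp : ∀ s t, φ (s, (t, A.pt)) = W.pt)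
    (hf : ∀ t a, φ (0, (t, a)) = f (suspMk t a)) :
    ∃ g : Hom (susp A) W, (∀ t a, g (suspMk t a) = φ (1, (t, a))) ∧ Homotopic f g := by
  obtain ⟨F, hF, hF'⟩ := exists_susp_lift φ hφ h0 h1 hp
  have hpt : ∀ s, F (s, (susp A).pt) = W.pt := fun s => (hF' s zero A.pt).trans (h0 _ _)
  refine ⟨⟨fun y => F (1, y), hF.comp ((FrlSmooth.const 1).prodMk FrlSmooth.id), hpt 1⟩,
    hF' 1, F, hF, hpt, ?_, fun _ => rfl⟩
  exact susp_ind fun t a => (hF' 0 t a).trans (hf t a)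

end Susp

section Cone

variable {A X : PointedFrl.{u}} (i : Hom A X) {W : PointedFrl.{v}}

/-- The point `[t, a]` of the flattened mapping cone. -/
def coneMk (t : FlatInterval) (a : A) : flatCone i := Quot.mk _ (Quot.mk _ (Sum.inl (t, a)))

theorem coneMk_smooth : FrlSmooth fun p : FlatInterval × A => coneMk i p.1 p.2 :=
  (FrlSmooth.quotMk _).comp ((FrlSmooth.quotMk _).comp FrlSmooth.inl)

theorem coneMk_one (a : A) : coneMk i one a = coneIncl i (i a) :=
  congrArg (Quot.mk _) (Quot.sound ⟨a, rfl, rfl⟩)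

theorem coneMk_zero (a : A) : coneMk i zero a = (flatCone i).pt :=
  Quot.sound ⟨⟨zero, a, Or.inl rfl, rfl⟩, ⟨zero, A.pt, Or.inl rfl, rfl⟩⟩

theorem coneMk_pt (t : FlatInterval) : coneMk i t A.pt = (flatCone i).pt :=
  Quot.sound ⟨⟨t, A.pt, Or.inr rfl, rfl⟩, ⟨zero, A.pt, Or.inl rfl, rfl⟩⟩

variable {i}

theorem cone_ind {p : flatCone i → Prop} (h : ∀ t a, p (coneMk i t a))
    (h' : ∀ x, p (coneIncl i x)) (y : flatCone i) : p y := by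
  rcases y with ⟨⟨⟨t, a⟩ | x⟩⟩
  exacts [h t a, h' x]

/-- A smooth family of maps on the flattened mapping cone, from compatible families on its two
parts. -/
theorem exists_cone_lift {Z : Type w} [FrolicherSpace Z] (φ : Z × (FlatInterval × A) → W)
    (ψ : Z × X → W) (hφ : FrlSmooth φ) (hψ : FrlSmooth ψ) (h0 : ∀ z a, φ (z, (zero, a)) = W.pt)
    (h1 : ∀ z a, φ (z, (one, a)) = ψ (z, i a)) (hp : ∀ z t, φ (z, (t, A.pt)) = W.pt) :
    ∃ F : Z × flatCone i → W, FrlSmooth F ∧ (∀ z t a, F (z, coneMk i t a) = φ (z, (t, a))) ∧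
      ∀ z x, F (z, coneIncl i x) = ψ (z, x) := by
  let L : Z × FlatCylinder i → W := fun p =>
    Quot.lift (Sum.elim (fun q => φ (p.1, q)) fun x => ψ (p.1, x)) (by
      rintro _ _ ⟨a, rfl, rfl⟩
      exact h1 p.1 a) p.2
  have hL : FrlSmooth L := FrlSmooth.of_prod_quot (FrlSmooth.of_prod_sum hφ hψ)
  have hbase : ∀ z, ∀ q ∈ flatConeBase i, L (z, q) = W.pt := by
    rintro z _ ⟨t, a, rfl | rfl, rfl⟩
    exacts [h0 z a, hp z t]
  let F : Z × flatCone i → W := fun p =>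
    Quot.lift (fun q => L (p.1, q))
      (fun q q' h => (hbase _ _ h.1).trans (hbase _ _ h.2).symm) p.2
  exact ⟨F, FrlSmooth.of_prod_quot hL, fun _ _ _ => rfl, fun _ _ => rfl⟩

theorem exists_cone_hom (φ : FlatInterval × A → W) (ψ : Hom X W) (hφ : FrlSmooth φ)
    (h0 : ∀ a, φ (zero, a) = W.pt) (h1 : ∀ a, φ (one, a) = ψ (i a))
    (hp : ∀ t, φ (t, A.pt) = W.pt) :
    ∃ h : Hom (flatCone i) W, (∀ t a, h (coneMk i t a) = φ (t, a)) ∧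
      ∀ x, h (coneIncl i x) = ψ x := by
  obtain ⟨F, hF, hF₁, hF₂⟩ := exists_cone_lift (i := i) (Z := unitInterval) (fun p => φ p.2)
    (fun p => ψ p.2) (hφ.comp FrlSmooth.snd) (ψ.smooth.comp FrlSmooth.snd)
    (fun _ => h0) (fun _ => h1) (fun _ => hp)
  exact ⟨⟨fun y => F (0, y), hF.comp ((FrlSmooth.const 0).prodMk FrlSmooth.id),
    (hF₁ 0 zero A.pt).trans (h0 _)⟩, hF₁ 0, hF₂ 0⟩

/-- Deforming a map on the flattened mapping cone along compatible families on its two parts. -/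
theorem exists_cone_homotopic (f : Hom (flatCone i) W)
    (φ : unitInterval × (FlatInterval × A) → W) (ψ : unitInterval × X → W) (hφ : FrlSmooth φ)
    (hψ : FrlSmooth ψ) (h0 : ∀ s a, φ (s, (zero, a)) = W.pt)
    (h1 : ∀ s a, φ (s, (one, a)) = ψ (s, i a)) (hp : ∀ s t, φ (s, (t, A.pt)) = W.pt)
    (hf : ∀ t a, φ (0, (t, a)) = f (coneMk i t a)) (hf' : ∀ x, ψ (0, x) = f (coneIncl i x)) :
    ∃ g : Hom (flatCone i) W, (∀ t a, g (coneMk i t a) = φ (1, (t, a))) ∧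
      (∀ x, g (coneIncl i x) = ψ (1, x)) ∧ Homotopic f g := by
  obtain ⟨F, hF, hF₁, hF₂⟩ := exists_cone_lift φ ψ hφ hψ h0 h1 hp
  have hpt : ∀ s, F (s, (flatCone i).pt) = W.pt := fun s => (hF₁ s zero A.pt).trans (h0 _ _)
  refine ⟨⟨fun y => F (1, y), hF.comp ((FrlSmooth.const 1).prodMk FrlSmooth.id), hpt 1⟩,
    hF₁ 1, hF₂ 1, F, hF, hpt, ?_, fun _ => rfl⟩
  exact cone_ind (fun t a => (hF₁ 0 t a).trans (hf t a)) fun x => (hF₂ 0 x).trans (hf' x)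

end Cone

/-! ### The three basic exactness statements. -/

section Exact

variable {A X : PointedFrl.{u}} (i : Hom A X) (W : PointedFrl.{u})

/-- Exactness at `[X, W]`. -/
theorem exactAt_base : Pointed.ExactAt ((coneIncl i).pullback W) (i.pullback W) := by
  rw [exactAt_pullback_iff]
  intro h
  constructor
  · rintro ⟨h', hh⟩
    -- The point `[1, a] = [i a]` slides down the cone to `[0, a]`, the basepoint.
    refine (hh.symm.comp_right i).trans ⟨fun p => h' (coneMk i (ofUnit (symm p.1)) p.2),
      ?_, ?_, ?_, ?_⟩
    · exact h'.smooth.comp ((coneMk_smooth i).comp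
        ((smooth_ofUnit.comp (FrlSmooth.symm.comp FrlSmooth.fst)).prodMk FrlSmooth.snd))
    · intro t
      simp only [coneMk_pt, h'.map_pt]
    · intro a
      simp only [symm_zero, ofUnit_one, coneMk_one]
      rfl
    · intro a
      simp only [symm_one, ofUnit_zero, coneMk_zero, h'.map_pt]
      rfl
  · intro hnull
    obtain ⟨N, hN, hp, h0, h1⟩ := hnull.symm
    -- The reversed null-homotopy starts at the basepoint and ends at `h ∘ i`, so it fills the cone;
    -- braking makes it smooth in the flattened coordinate.
    obtain ⟨h', -, hh'⟩ := exists_cone_hom (i := i) (fun p => N (brake p.1, p.2)) h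
      (hN.comp ((smooth_brake.comp FrlSmooth.fst).prodMk FrlSmooth.snd))
      (fun a => by rw [brake_zero, h0]; rfl) (fun a => by rw [brake_one, h1]; rfl)
      (fun t => hp _)
    have e : h'.comp (coneIncl i) = h := Hom.ext (funext hh')
    exact ⟨h', e ▸ Homotopic.refl _⟩

/-- Exactness at `[𝐓_i, W]`. -/
theorem exactAt_cone :
    Pointed.ExactAt ((coneQuot i).pullback W) ((coneIncl i).pullback W) := by
  rw [exactAt_pullback_iff]
  intro h
  constructor
  · rintro ⟨h', hh⟩
    have e : (h'.comp (coneQuot i)).comp (coneIncl i) = Hom.trivial X W :=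
      Hom.ext (funext fun x => h'.map_pt)
    exact e ▸ hh.symm.comp_right (coneIncl i)
  · rintro ⟨N, hN, hp, h0, h1⟩
    -- The braked coordinate is split in thirds: `β` runs through the cone in the first, `δ` runs
    -- along the null-homotopy in the last, and the middle third is a resting zone where the two
    -- formulas agree and can be glued.
    let β : FlatInterval → unitInterval := fun t => step 0 (1 / 3) (brake t)
    let δ : FlatInterval → unitInterval := fun t => step (2 / 3) 1 (brake t)
    have hβ : FrlSmooth β := (smooth_step _ _).comp (FrlSmooth.unitInterval_val.comp smooth_brake)
    have hδ : FrlSmooth δ := (smooth_step _ _).comp (FrlSmooth.unitInterval_val.comp smooth_brake)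
    have hβ0 : ∀ t, brake t = 0 → β t = 0 := fun t ht =>
      step_eq_zero (by norm_num) (by simp [ht])
    have hβ1 : ∀ t, 1 / 3 ≤ (brake t : ℝ) → β t = 1 := fun t ht =>
      step_eq_one (by norm_num) ht
    have hδ0 : ∀ t, (brake t : ℝ) ≤ 2 / 3 → δ t = 0 := fun t ht =>
      step_eq_zero (by norm_num) ht
    have hδ1 : δ one = 1 := step_eq_one (by norm_num) (by simp)
    have hβone : β one = 1 := hβ1 _ (by rw [brake_one]; norm_num)
    have hmix := smooth_mix hβ (fun t ht => hβ0 t (brake_eq_zero ht))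
      (fun t ht => hβ1 t (by rw [brake_eq_one ht]; norm_num))
    -- The cone coordinate is first deformed to `β`, which frees a collar next to `X`.
    obtain ⟨g₁, hg₁, hg₁', H₁⟩ := exists_cone_homotopic h
      (fun p => h (coneMk i (ofUnit (mix p.1 (toUnit p.2.1) (β p.2.1))) p.2.2))
      (fun p => h (coneIncl i p.2))
      (h.smooth.comp ((coneMk_smooth i).comp ((hmix.comp (FrlSmooth.fst.prodMk
        (FrlSmooth.fst.comp FrlSmooth.snd))).prodMk (FrlSmooth.snd.comp FrlSmooth.snd))))
      (h.smooth.comp ((coneIncl i).smooth.comp FrlSmooth.snd))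
      (fun s a => by
        simp only [toUnit_zero, hβ0 _ brake_zero, mix_self, ofUnit_zero, coneMk_zero, h.map_pt])
      (fun s a => by simp only [toUnit_one, hβone, mix_self, ofUnit_one, coneMk_one])
      (fun s t => by simp only [coneMk_pt, h.map_pt])
      (fun t a => by simp only [mix_zero, ofUnit_toUnit]) (fun x => rfl)
    simp only [mix_one] at hg₁
    -- At parameter `s` the collar follows `N` from time 0 to time `s`, which matches `N (s, x)` on
    -- `X`.
    let φ : unitInterval × (FlatInterval × A) → W := fun p =>
      if (brake p.2.1 : ℝ) ≤ 1 / 2 then h (coneMk i (ofUnit (β p.2.1)) p.2.2)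
      else N (mix p.1 0 (δ p.2.1), i p.2.2)
    have hend : ∀ a, h (coneMk i (ofUnit 1) a) = N (0, i a) := fun a => by
      rw [ofUnit_one, coneMk_one, h0]
      rfl
    have hφ : FrlSmooth φ := by
      refine FrlSmooth.glue (ρ := fun p : unitInterval × (FlatInterval × A) => (brake p.2.1 : ℝ))
        (FrlSmooth.unitInterval_val.comp
          (smooth_brake.comp (FrlSmooth.fst.comp FrlSmooth.snd)))
        (φ := fun p => h (coneMk i (ofUnit (β p.2.1)) p.2.2))
        (ψ := fun p => N (mix p.1 0 (δ p.2.1), i p.2.2))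
        (h.smooth.comp ((coneMk_smooth i).comp ((smooth_ofUnit.comp (hβ.comp
          (FrlSmooth.fst.comp FrlSmooth.snd))).prodMk (FrlSmooth.snd.comp FrlSmooth.snd))))
        (hN.comp ((FrlSmooth.mix FrlSmooth.fst (FrlSmooth.const 0) (hδ.comp
          (FrlSmooth.fst.comp FrlSmooth.snd))).prodMk
            (i.smooth.comp (FrlSmooth.snd.comp FrlSmooth.snd))))
        (show (1 / 2 : ℝ) < 2 / 3 by norm_num) ?_ ?_
      · rintro ⟨s, t, a⟩ ht
        simp only at ht
        by_cases hle : (brake t : ℝ) ≤ 1 / 2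
        · simp only [φ, if_pos hle]
        · simp only [φ, if_neg hle]
          rw [hδ0 t ht.le, mix_self, hβ1 t (by linarith), hend]
      · rintro ⟨s, t, a⟩ ht
        simp only at ht
        simp only [φ, if_neg (not_le.2 ht)]
    have hφzero : ∀ s a, φ (s, (zero, a)) = W.pt := fun s a => by
      simp only [φ, brake_zero]
      rw [if_pos (by norm_num), hβ0 _ brake_zero, ofUnit_zero, coneMk_zero, h.map_pt]
    have hφone : ∀ s a, φ (s, (one, a)) = N (s, i a) := fun s a => by
      simp only [φ, brake_one]
      rw [if_neg (by norm_num), hδ1]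
      congr 2
      exact Subtype.ext (by simp [mix])
    have hφpt : ∀ s t, φ (s, (t, A.pt)) = W.pt := fun s t => by
      simp only [φ]
      split_ifs
      · rw [coneMk_pt, h.map_pt]
      · rw [i.map_pt, hp]
    obtain ⟨g₂, hg₂, hg₂', H₂⟩ := exists_cone_homotopic g₁ φ N hφ hN hφzero hφone hφpt
      (fun t a => by
        rw [hg₁]
        by_cases hle : (brake t : ℝ) ≤ 1 / 2
        · simp only [φ, if_pos hle]
        · simp only [φ, if_neg hle]
          rw [mix_zero, hβ1 t (by linarith), hend])
      (fun x => by rw [hg₁', h0]; rfl)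
    -- At parameter 1 the map is trivial on `X`, hence both ends of the cone coordinate go to the
    -- basepoint.
    obtain ⟨h', hh'⟩ := exists_susp_hom (fun q => φ (1, q))
      (hφ.comp ((FrlSmooth.const 1).prodMk FrlSmooth.id)) (hφzero 1)
      (fun a => by rw [hφone, h1]; rfl) (hφpt 1)
    have e : h'.comp (coneQuot i) = g₂ := by
      refine Hom.ext (funext (cone_ind (fun t a => ?_) fun x => ?_))
      · exact (hh' t a).trans (hg₂ t a).symm
      · exact h'.map_pt.trans ((hg₂' x).trans (h1 x)).symm
    exact ⟨h', e ▸ (H₁.trans H₂).symm⟩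

/-- The composite `𝐓_i → Σ A → Σ X` is null-homotopic. -/
theorem susp_comp_coneQuot_homotopic :
    Homotopic (i.susp.comp (coneQuot i)) (Hom.trivial (flatCone i) (susp X)) := by
  have hmix := smooth_mix smooth_brake (fun _ => brake_eq_zero) (fun _ => brake_eq_one)
  obtain ⟨g₁, hg₁, hg₁', H₁⟩ := exists_cone_homotopic (i.susp.comp (coneQuot i))
    (fun p => suspMk (ofUnit (mix p.1 (toUnit p.2.1) (brake p.2.1))) (i p.2.2))
    (fun _ => (susp X).pt)
    (suspMk_smooth.comp ((hmix.comp (FrlSmooth.fst.prodMk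
      (FrlSmooth.fst.comp FrlSmooth.snd))).prodMk
        (i.smooth.comp (FrlSmooth.snd.comp FrlSmooth.snd))))
    (FrlSmooth.const _)
    (fun s a => by
      simp only [toUnit_zero, brake_zero, mix_self]
      exact suspMk_eq_pt (Or.inl rfl))
    (fun s a => by
      simp only [toUnit_one, brake_one, mix_self]
      exact suspMk_eq_pt (Or.inr (Or.inl rfl)))
    (fun s t => suspMk_eq_pt (Or.inr (Or.inr i.map_pt)))
    (fun t a => by
      simp only [mix_zero, ofUnit_toUnit]
      rfl)
    (fun x => i.susp.map_pt.symm)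
  simp only [mix_one] at hg₁
  -- Since `[x] ↦ *` equals `[x] ↦ 1 ∧ x`, scaling the braked coordinate to 0 is defined on `X` as
  -- well and contracts everything to `0 ∧ x = *`.
  obtain ⟨g₂, hg₂, hg₂', H₂⟩ := exists_cone_homotopic g₁
    (fun p => suspMk (ofUnit (mix p.1 (brake p.2.1) 0)) (i p.2.2))
    (fun p => suspMk (ofUnit (mix p.1 1 0)) p.2)
    (suspMk_smooth.comp ((smooth_ofUnit.comp (FrlSmooth.mix FrlSmooth.fst
      (smooth_brake.comp (FrlSmooth.fst.comp FrlSmooth.snd)) (FrlSmooth.const 0))).prodMk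
        (i.smooth.comp (FrlSmooth.snd.comp FrlSmooth.snd))))
    (suspMk_smooth.comp ((smooth_ofUnit.comp (FrlSmooth.mix FrlSmooth.fst
      (FrlSmooth.const 1) (FrlSmooth.const 0))).prodMk FrlSmooth.snd))
    (fun s a => by
      simp only [brake_zero, mix_self]
      exact suspMk_eq_pt (Or.inl rfl))
    (fun s a => by simp only [brake_one])
    (fun s t => suspMk_eq_pt (Or.inr (Or.inr i.map_pt)))
    (fun t a => by simp only [mix_zero, hg₁])
    (fun x => by
      rw [hg₁', mix_zero]
      exact suspMk_eq_pt (Or.inr (Or.inl rfl)))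
  have e : g₂ = Hom.trivial (flatCone i) (susp X) := by
    refine Hom.ext (funext (cone_ind (fun t a => ?_) fun x => ?_))
    · rw [hg₂, mix_one]
      exact suspMk_eq_pt (Or.inl rfl)
    · rw [hg₂', mix_one]
      exact suspMk_eq_pt (Or.inl rfl)
  exact e ▸ H₁.trans H₂

/-- Exactness at `[Σ A, W]`. -/
theorem exactAt_susp_base :
    Pointed.ExactAt (i.susp.pullback W) ((coneQuot i).pullback W) := by
  rw [exactAt_pullback_iff]
  intro h
  constructor
  · rintro ⟨h', hh⟩
    have e : h'.comp (Hom.trivial (flatCone i) (susp X)) = Hom.trivial (flatCone i) W :=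
      Hom.ext (funext fun _ => h'.map_pt)
    have H := (susp_comp_coneQuot_homotopic i).comp_left h'
    rw [e] at H
    exact (hh.symm.comp_right (coneQuot i)).trans H
  -- On the square of pairs (time of `N`, cone coordinate), `N` is trivial on the sides time 1 and
  -- coordinate 0. Paths may start anywhere on these sides and must end at the corner `(0, 1)`,
  -- where `N` is also trivial.
  · rintro ⟨N, hN, hp, h0, h1⟩
    have h1' : ∀ y, N (1, y) = W.pt := h1
    have hmk : ∀ t a, N (0, coneMk i t a) = h (suspMk t a) := fun t a => h0 _
    have hone : ∀ a, h (suspMk one a) = W.pt := fun a => by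
      rw [suspMk_eq_pt (Or.inr (Or.inl rfl)), h.map_pt]
    have hincl : ∀ x, N (0, coneIncl i x) = W.pt := fun x => (h0 _).trans h.map_pt
    have hsymm : FrlSmooth fun t : FlatInterval => symm (brake t) :=
      FrlSmooth.symm.comp smooth_brake
    have hmix := smooth_mix smooth_brake (fun _ => brake_eq_zero) (fun _ => brake_eq_one)
    have htime : FrlSmooth fun p : unitInterval × (FlatInterval × A) => p.2.1 :=
      FrlSmooth.fst.comp FrlSmooth.snd
    have hpoint : FrlSmooth fun p : unitInterval × (FlatInterval × A) => p.2.2 :=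
      FrlSmooth.snd.comp FrlSmooth.snd
    obtain ⟨g₁, hg₁, H₁⟩ := exists_susp_homotopic h
      (fun p => h (suspMk (ofUnit (mix p.1 (toUnit p.2.1) (brake p.2.1))) p.2.2))
      (h.smooth.comp (suspMk_smooth.comp
        ((hmix.comp (FrlSmooth.fst.prodMk htime)).prodMk hpoint)))
      (fun s a => by
        simp only [toUnit_zero, brake_zero, mix_self, ofUnit_zero]
        rw [suspMk_eq_pt (Or.inl rfl), h.map_pt])
      (fun s a => by simp only [toUnit_one, brake_one, mix_self, ofUnit_one, hone])
      (fun s t => by rw [suspMk_eq_pt (Or.inr (Or.inr rfl)), h.map_pt])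
      (fun t a => by simp only [mix_zero, ofUnit_toUnit])
    simp only [mix_one] at hg₁
    -- From the edge at time 0 to the diagonal, with `b` the braked coordinate: the path `(s (1 -
    -- b), b)` starts on the side with coordinate 0.
    obtain ⟨g₂, hg₂, H₂⟩ := exists_susp_homotopic g₁
      (fun p => N (mix p.1 0 (symm (brake p.2.1)), coneMk i (ofUnit (brake p.2.1)) p.2.2))
      (hN.comp ((FrlSmooth.mix FrlSmooth.fst (FrlSmooth.const 0) (hsymm.comp htime)).prodMk
        ((coneMk_smooth i).comp
          ((smooth_ofUnit.comp (smooth_brake.comp htime)).prodMk hpoint))))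
      (fun s a => by simp only [brake_zero, ofUnit_zero, coneMk_zero, hp])
      (fun s a => by simp only [brake_one, symm_one, mix_self, ofUnit_one, hmk, hone])
      (fun s t => by simp only [coneMk_pt, hp])
      (fun t a => by simp only [mix_zero, hmk, hg₁])
    simp only [mix_one] at hg₂
    -- From the diagonal to the edge with coordinate 1: the path `(1 - b, (1 - s) b + s)` starts on
    -- the side with time 1.
    obtain ⟨g₃, hg₃, H₃⟩ := exists_susp_homotopic g₂
      (fun p => N (symm (brake p.2.1), coneMk i (ofUnit (mix p.1 (brake p.2.1) 1)) p.2.2))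
      (hN.comp ((hsymm.comp htime).prodMk ((coneMk_smooth i).comp
        ((smooth_ofUnit.comp (FrlSmooth.mix FrlSmooth.fst (smooth_brake.comp htime)
          (FrlSmooth.const 1))).prodMk hpoint))))
      (fun s a => by simp only [brake_zero, symm_zero, h1'])
      (fun s a => by simp only [brake_one, symm_one, mix_self, ofUnit_one, hmk, hone])
      (fun s t => by simp only [coneMk_pt, hp])
      (fun t a => by simp only [mix_zero, hg₂])
    simp only [mix_one, ofUnit_one, coneMk_one] at hg₃
    -- On the final edge only points `[1, a] = [i a]` occur, so the same formula makes sense for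
    -- every `x` in `X`.
    obtain ⟨h', hh'⟩ := exists_susp_hom (fun q : FlatInterval × X =>
        N (symm (brake q.1), coneIncl i q.2))
      (hN.comp ((hsymm.comp FrlSmooth.fst).prodMk ((coneIncl i).smooth.comp FrlSmooth.snd)))
      (fun x => by simp only [brake_zero, symm_zero, h1'])
      (fun x => by simp only [brake_one, symm_one, hincl])
      (fun t => by rw [(coneIncl i).map_pt, hp])
    have e : h'.comp i.susp = g₃ :=
      Hom.ext (funext (susp_ind fun t a => (hh' t (i a)).trans (hg₃ t a).symm))
    exact ⟨h', e ▸ ((H₁.trans H₂).trans H₃).symm⟩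

end Exact

end PointedFrl

/-- The long exact sequence of a cofibration. The flattening of the mapping cone at its free end
already provides the homotopy extensions that the argument needs, so that the extension property of
`i` itself is not used. -/
theorem theorem541 {A X : PointedFrl.{u}} (i : PointedFrl.Hom A X)
    (hi : PointedFrl.IsCofibration i) (W : PointedFrl.{u}) (n : ℕ) :
    -- exactness at `[Σⁿ X, W]`
    Pointed.ExactAt (((PointedFrl.coneIncl i).iterSusp n).pullback W)
        ((i.iterSusp n).pullback W) ∧
    -- exactness at `[Σⁿ 𝐓_i, W]`
    Pointed.ExactAt (((PointedFrl.coneQuot i).iterSusp n).pullback W)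
        (((PointedFrl.coneIncl i).iterSusp n).pullback W) ∧
    -- exactness at `[Σⁿ⁺¹ A, W]`
    Pointed.ExactAt ((i.iterSusp (n + 1)).pullback W)
        (((PointedFrl.coneQuot i).iterSusp n).pullback W) :=
  ⟨PointedFrl.exactAt_iterSusp n (PointedFrl.exactAt_base i) W,
    PointedFrl.exactAt_iterSusp n (PointedFrl.exactAt_cone i) W,
    -- The recursion suspends the map first, so `i.iterSusp (n + 1)` unfolds to `i.susp.iterSusp n`.
    PointedFrl.exactAt_iterSusp n (PointedFrl.exactAt_susp_base i) W⟩
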